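/- **Model.** Let $y_t\in\{0,1\}$ ($t\ge 1$) be known, $v_0=1$ and $v_t=1+\sum_{i\le t}y_i$. $G_0$ is a single isolated vertex, whose degree is set to be $1$. If $y_t=1$ (vertex-step), $G_t$ arises from $G_{t-1}$ by adding a new vertex and joining it to a vertex $u$ chosen with probability proportional to $d(u)+a_t$, where $d(u)$ is the degree of $u$ in $G_{t-1}$; if $y_t=0$ (edge-step), by adding an edge $\{u,w\}$ whose ends are chosen independently, each with probability proportional to $d(\cdot)+a_t$ (loops are allowed and count twice in the degree). Let $x_t$ be the number of vertices of degree one in $G_t$. For integers $0\le t_0\le t_1$ let $f_{t_0,t_1}(a)=E(x_{t_1}\mid x_0,\dots,x_{t_0})$, computed in the model with constant parameter $a>-1$, and let the estimator of the parameter from the interval $[t_0,t_1]$ be $\hat a=\arg\min_{a>-1}(f_{t_0,t_1}(a)-x_{t_1})^2$ (any minimizer; arbitrary if there is none). For reals $s\le t$ put $\tilde L_{[s,t)}=|\hat\alpha_{s,1}-\hat\alpha_{t,2}|$, where $\hat\alpha_{s,1}$ and $\hat\alpha_{t,2}$ are the estimators from the integer times in $[0,s)$ and in $[t,T]$. **Procedure.**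 Let $T\in\mathbb N$, $k\ge5$ and let $c>0$ be a constant. Divide $[0,T)$ at $0=s_0<s_1<\dots<s_k=T$ into $B_i=[s_{i-1},s_i)$, $1\le i\le k$, each of length at least $cT$. Let $\hat j$ maximize $\tilde L_{B_i}$ over $2\le i\le k-1$ and put $V^{(0)}=V=B_{\hat j-1}\cup B_{\hat j}\cup B_{\hat j+1}$ if $3\le\hat j\le k-2$, $V=B_2\cup B_3\cup B_4$ if $\hat j=2$, and $V=B_{k-3}\cup B_{k-2}\cup B_{k-1}$ if $\hat j=k-1$. Given $V^{(d)}$, divide it, by a rule that may depend on $T$, $d$ and the interval $V^{(d)}$, into $k$ consecutive half-open intervals $B_1',\dots,B_k'$, each of length at least $c\,|V^{(d)}|$ (for example, of equal length). Let $\hat j$ maximize $\tilde L_{B_i'}$ over $1\le i\le k$ and put $V^{(d+1)}=B'_{\hat j-1}\cup B'_{\hat j}\cup B'_{\hat j+1}$ if $2\le\hat j\le k-1$, $B'_1\cup B'_2\cup B'_3$ if $\hat j=1$, and $B'_{k-2}\cup B'_{k-1}\cup B'_k$ if $\hat j=k$. Ties are broken arbitrarily. **Proposition.** Let $\alpha_1\ne\alpha_2$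 be constants in $(-1,\infty)$, and let $p,c>0$ be constants. For every $T$ let the model on $[0,T]$ have $a_t=\alpha_1$ for $0\le t<R$ and $a_t=\alpha_2$ for $R\le t\le T$, and suppose $v_t/t\ge p$ for $0<t\le T$. Here $R$, the sequence $y$, the divisions, $k\ge 5$ and $q\ge0$ may depend on $T$, with $k$ and $q$ bounded. Suppose that, for all large $T$, the first division is as above and $s_1\le R\le s_{k-1}$. Then $$\lim_{T\to\infty}P\big(R\in \overline{V^{(q)}}\big)=1,$$ where $\overline{V^{(q)}}=[l,r]$ is the closure of $V^{(q)}=[l,r)$. If moreover $R<s_{k-1}$ for all large $T$, then $$\lim_{T\to\infty}P\big(R\in V^{(q)}\big)=1.$$ -/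

import Mathlib

open Filter Topology MeasureTheory

namespace EvolvingNetwork

/-- A finite undirected multigraph, loops allowed, with vertices `0, …, verts - 1`.
An edge is recorded as a pair of endpoints; their order plays no role. -/
structure Network where
  verts : ℕ
  edges : List (ℕ × ℕ)

namespace Network

/-- The initial graph: one isolated vertex, labelled `0`. -/
def initial : Network := ⟨1, []⟩

/-- The degree of `u`: the number of edge ends at `u` (a loop counts twice). By the convention of
the model the initial vertex `0` has degree one before any edge is added, so it carries one extra
unit of degree. -/
def degree (g : Network) (u : ℕ) : ℕ :=
  (if u = 0 then 1 else 0) +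
    (g.edges.map fun e => (if e.1 = u then 1 else 0) + (if e.2 = u then 1 else 0)).sum

/-- The number of leaves, i.e. of vertices of degree one. -/
def leaves (g : Network) : ℕ :=
  ((Finset.range g.verts).filter fun u => g.degree u = 1).card

/-- The weight `d(u) + a` of the vertex `u` (and `0` if `u` is not a vertex). -/
noncomputable def weight (g : Network) (a : ℝ) (u : ℕ) : ENNReal :=
  if u < g.verts then ENNReal.ofReal ((g.degree u : ℝ) + a) else 0

theorem tsum_weight_ne_top (g : Network) (a : ℝ) : ∑' u, g.weight a u ≠ ⊤ := by
  rw [tsum_eq_sum (s := Finset.range g.verts)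
    (fun u hu => by simp only [Finset.mem_range] at hu; simp [weight, hu])]
  refine (ENNReal.sum_lt_top.2 fun u _ => ?_).ne
  unfold weight
  split_ifs <;> simp

open Classical in
/-- A random vertex, chosen with probability proportional to `d(u) + a`.
(The fallback value never occurs for `a > -1` and a graph with the vertex `0`, because the weight
of the vertex `0` is then positive.) -/
noncomputable def randomVertex (g : Network) (a : ℝ) : PMF ℕ :=
  if h : ∑' u, g.weight a u ≠ 0 then PMF.normalize (g.weight a) h (g.tsum_weight_ne_top a)
  else PMF.pure 0

/-- One step of the evolution. Vertex-step (`true`): add a new vertex and join it to a random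
vertex `u`. Edge-step (`false`): add an edge between two independently chosen random vertices. -/
noncomputable def step (vertexStep : Bool) (a : ℝ) (g : Network) : PMF Network :=
  if vertexStep then
    (g.randomVertex a).map fun u => ⟨g.verts + 1, (g.verts, u) :: g.edges⟩
  else
    (g.randomVertex a).bind fun u =>
      (g.randomVertex a).map fun w => ⟨g.verts, (u, w) :: g.edges⟩

end Network

/-- Trajectories `G_0, G_1, G_2, …` of graphs, with the discrete σ-algebra. -/
def Trajectory : Type := ℕ → Network

instance : MeasurableSpace Trajectory := ⊤

/-- `x_t`, the number of leaves of `G_t`. -/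
def leafCount (G : Trajectory) (t : ℕ) : ℕ := (G t).leaves

/-- `v_t`, the number of vertices of `G_t`, when the steps `1 ≤ i ≤ t` with `y i = true` are the
vertex-steps. -/
def vertexCount (y : ℕ → Bool) (t : ℕ) : ℕ :=
  1 + ((Finset.Icc 1 t).filter fun i => y i = true).card

/-- The law of `G_0, …, G_T` (frozen at `G_T` after time `T`), where the step from `G_{t-1}` to
`G_t` is a vertex-step or an edge-step according to `y t` and uses the parameter `a t`. -/
noncomputable def trajectoryLaw (y : ℕ → Bool) (a : ℕ → ℝ) : ℕ → PMF Trajectory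
  | 0 => PMF.pure fun _ => Network.initial
  | T + 1 => (trajectoryLaw y a T).bind fun G =>
      (Network.step (y (T + 1)) (a (T + 1)) (G T)).map fun g =>
        fun i => if i ≤ T then G i else g

/-- `f_{t₀,t₁}(a) = E(x_{t₁} | x_0, …, x_{t₀})` in the model with `a_t = a`, evaluated at the
observed values `x` of the leaf counts. -/
noncomputable def condMean (y : ℕ → Bool) (t₀ t₁ : ℕ) (x : ℕ → ℕ) (a : ℝ) : ℝ :=
  ∫ G, (leafCount G t₁ : ℝ) ∂(ProbabilityTheory.cond (trajectoryLaw y (fun _ => a) t₁).toMeasure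
    {G | ∀ i ≤ t₀, leafCount G i = x i})

/-- `a` minimizes `(f_{t₀,t₁}(a) - x_{t₁})²` over the parameter space `(-1, ∞)`. -/
def IsLeastSquares (y : ℕ → Bool) (t₀ t₁ : ℕ) (x : ℕ → ℕ) (a : ℝ) : Prop :=
  -1 < a ∧ ∀ b : ℝ, -1 < b →
    (condMean y t₀ t₁ x a - x t₁) ^ 2 ≤ (condMean y t₀ t₁ x b - x t₁) ^ 2

/-- `est t₀ t₁` is an estimate of the parameter from the time interval `[t₀, t₁]`, given the
observed leaf counts `x`: a least squares estimate whenever there is one. -/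
def IsEstimator (y : ℕ → Bool) (x : ℕ → ℕ) (est : ℕ → ℕ → ℝ) : Prop :=
  ∀ t₀ t₁, t₀ ≤ t₁ → (∃ a, IsLeastSquares y t₀ t₁ x a) → IsLeastSquares y t₀ t₁ x (est t₀ t₁)

/-- The statistic `L̃_{[s,t)}`: the distance between the estimate from the integer times in `[0, s)`
(the last one is `⌈s⌉ - 1`) and the estimate from those in `[t, T]` (the first one is `⌈t⌉`). -/
noncomputable def splitStat (est : ℕ → ℕ → ℝ) (T : ℕ) (s t : ℝ) : ℝ :=
  |est 0 (⌈s⌉₊ - 1) - est ⌈t⌉₊ T|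

/-- `b 0, …, b k` are the division points of `[l, r)` into the `k` consecutive intervals
`[b (i - 1), b i)`, `1 ≤ i ≤ k`, each of length at least `δ`. -/
def IsDivision (k : ℕ) (l r δ : ℝ) (b : ℕ → ℝ) : Prop :=
  b 0 = l ∧ b k = r ∧ ∀ i < k, δ ≤ b (i + 1) - b i

/-- `j` maximizes `L̃` of the intervals `[b (i - 1), b i)` over `m ≤ i ≤ n`. -/
def IsArgmax (est : ℕ → ℕ → ℝ) (T : ℕ) (b : ℕ → ℝ) (m n j : ℕ) : Prop :=
  j ∈ Finset.Icc m n ∧ ∀ i ∈ Finset.Icc m n,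
    splitStat est T (b (i - 1)) (b i) ≤ splitStat est T (b (j - 1)) (b j)

/-- The end points of the interval `V` of the first stage, a union of three consecutive intervals
among `[s (i - 1), s i)`, `2 ≤ i ≤ k - 1`. -/
def firstInterval (k : ℕ) (s : ℕ → ℝ) (j : ℕ) : ℝ × ℝ :=
  if j = 2 then (s 1, s 4)
  else if j = k - 1 then (s (k - 4), s (k - 1))
  else (s (j - 2), s (j + 1))

/-- The end points of the new interval of a later stage, a union of three consecutive intervals
among `[b (i - 1), b i)`, `1 ≤ i ≤ k`. -/
def nextInterval (k : ℕ) (b : ℕ → ℝ) (j : ℕ) : ℝ × ℝ :=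
  if j = 1 then (b 0, b 3)
  else if j = k then (b (k - 3), b k)
  else (b (j - 2), b (j + 1))

/-- The end points `(l, r)` of the possible intervals `V^{(d)} = [l, r)` (with `V^{(0)} = V`); there
are several only if an argmax is not unique. The first division has the points `s i`, and
`div d l r` are the division points used for `V^{(d)} = [l, r)`. -/
def detected (est : ℕ → ℕ → ℝ) (T k : ℕ) (s : ℕ → ℝ) (div : ℕ → ℝ → ℝ → ℕ → ℝ) :
    ℕ → Set (ℝ × ℝ)
  | 0 => {V | ∃ j, IsArgmax est T s 2 (k - 1) j ∧ V = firstInterval k s j}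
  | d + 1 => {V | ∃ U ∈ detected est T k s div d, ∃ j,
      IsArgmax est T (div d U.1 U.2) 1 k j ∧ V = nextInterval k (div d U.1 U.2) j}

/-- The parameter `a_t` with the single change point `R`. -/
noncomputable def changeParam (α₁ α₂ : ℝ) (R t : ℕ) : ℝ := if t < R then α₁ else α₂

/-- The event that the set `I V` contains `R`, where `V` is the interval `V^{(q)}`, whichever
least squares estimates and argmaxes were used to produce it. -/
def containsEvent (y : ℕ → Bool) (T k q : ℕ) (s : ℕ → ℝ) (div : ℕ → ℝ → ℝ → ℕ → ℝ)
    (I : ℝ → ℝ → Set ℝ) (R : ℕ) : Set Trajectory :=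
  {G | ∀ est, IsEstimator y (leafCount G) est →
    ∀ V ∈ detected est T k s div q, (R : ℝ) ∈ I V.1 V.2}

end EvolvingNetwork

/-! The total weight of `G_t` depends only on `t`, and every leaf has the same weight `1 + a`. Hence
the expected next leaf count is an affine function `stepMean` of the current one, with slope
`keepProb` in `[0, 1]`. Conditional means given a history of leaf counts therefore follow a
deterministic recursion, `meanFrom` (`condMean_eq_meanFrom`).

Randomness enters only once. A step adds at most 4 to the second moment about the mean, and the
slope contracts old deviations. Chebyshev on a grid with boundedly many points, together with
bounded increments, shows that all leaf counts up to `T` are within `ε * T` of their means, except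
with probability `O(1 / T)` (`exists_toMeasure_exists_lt_abs_leafCount_sub_le`). Everything
afterwards is deterministic on this event, `IsTypical`.

The mean is continuous and decreasing in the parameter. Raising the parameter by `g` during a
positive fraction of the time lowers the mean by a multiple of `T` (`exists_mul_le_meanLeaves_sub`):
because vertices have positive density, there are linearly many leaves, and each is lost in a given
step with probability only of order `1 / T`. So an estimate from a stretch with constant parameter
is close to that parameter, while an estimate from a mixed stretch stays a fixed `ρ` away from the
wrong value (`exists_estimate_bounds`). The statistic is thus almost `|α₁ - α₂|` on an interval
containing `R`, and smaller by a fixed amount on an interval far from `R`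
(`exists_splitStat_threshold`).

A maximizing block is consequently less than one minimal block length away from `R`, so the union of
three blocks contains `R`. Only boundedly many stages occur, so all block lengths remain above a
fixed multiple of `T` and one threshold serves every stage (`detected_subset`). -/

namespace EvolvingNetwork

/-! ### Expectations of nonnegative functions under a `PMF` -/

/-- The expectation of an extended nonnegative function. -/
noncomputable def expect {α : Type*} (p : PMF α) (f : α → ENNReal) : ENNReal := ∑' x, p x * f x

section Expect

variable {α β : Type*}

theorem expect_pure (x : α) (f : α → ENNReal) : expect (PMF.pure x) f = f x := by
  unfold expect
  rw [tsum_eq_single x (fun b hb => by simp [PMF.pure_apply_of_ne _ _ hb])]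
  simp

theorem expect_bind (p : PMF α) (q : α → PMF β) (f : β → ENNReal) :
    expect (p.bind q) f = expect p fun x => expect (q x) f := by
  unfold expect
  simp only [PMF.bind_apply, ← ENNReal.tsum_mul_right, ← ENNReal.tsum_mul_left]
  rw [ENNReal.tsum_comm]
  simp only [mul_assoc]

theorem expect_map (p : PMF α) (g : α → β) (f : β → ENNReal) :
    expect (p.map g) f = expect p fun x => f (g x) := by
  rw [← PMF.bind_pure_comp, expect_bind]
  simp only [Function.comp_apply, expect_pure]

theorem expect_congr {p : PMF α} {f g : α → ENNReal} (h : ∀ x ∈ p.support, f x = g x) :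
    expect p f = expect p g := by
  unfold expect
  refine tsum_congr fun x => ?_
  by_cases hx : x ∈ p.support
  · rw [h x hx]
  · rw [(PMF.apply_eq_zero_iff _ _).2 hx]; simp

theorem expect_mono {p : PMF α} {f g : α → ENNReal} (h : ∀ x ∈ p.support, f x ≤ g x) :
    expect p f ≤ expect p g := by
  unfold expect
  refine ENNReal.tsum_le_tsum fun x => ?_
  by_cases hx : x ∈ p.support
  · gcongr; exact h x hx
  · rw [(PMF.apply_eq_zero_iff _ _).2 hx]; simp

theorem expect_add (p : PMF α) (f g : α → ENNReal) :
    (expect p fun x => f x + g x) = expect p f + expect p g := by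
  unfold expect
  rw [← ENNReal.tsum_add]
  simp only [mul_add]

theorem expect_const_mul (p : PMF α) (c : ENNReal) (f : α → ENNReal) :
    (expect p fun x => c * f x) = c * expect p f := by
  unfold expect
  rw [← ENNReal.tsum_mul_left]
  refine tsum_congr fun x => ?_
  ring

theorem expect_const (p : PMF α) (c : ENNReal) : (expect p fun _ => c) = c := by
  unfold expect
  rw [ENNReal.tsum_mul_right, p.tsum_coe, one_mul]

theorem expect_indicator_one [MeasurableSpace α] (p : PMF α) {s : Set α} (hs : MeasurableSet s) :
    expect p (s.indicator 1) = p.toMeasure s := by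
  rw [p.toMeasure_apply hs]
  unfold expect
  refine tsum_congr fun x => ?_
  by_cases hx : x ∈ s <;> simp [hx]

theorem lintegral_toMeasure_eq_expect [MeasurableSpace α] (p : PMF α)
    (h : ∀ s : Set α, MeasurableSet s) (f : α → ENNReal) : ∫⁻ x, f x ∂p.toMeasure = expect p f := by
  have hp : p.toMeasure = Measure.sum fun x => p x • Measure.dirac x := by
    ext s hs
    rw [p.toMeasure_apply hs, Measure.sum_apply _ hs]
    refine tsum_congr fun x => ?_
    by_cases hx : x ∈ s <;> simp [hx, Measure.dirac_apply' _ hs]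
  have hf : Measurable f := fun s _ => h _
  rw [hp, lintegral_sum_measure]
  simp only [lintegral_smul_measure, lintegral_dirac' _ hf, smul_eq_mul]
  rfl

/-- Markov's inequality. -/
theorem mul_toMeasure_le_expect [MeasurableSpace α] (p : PMF α) {s : Set α} (hs : MeasurableSet s)
    (c : ENNReal) (f : α → ENNReal) (h : ∀ x ∈ s, c ≤ f x) : c * p.toMeasure s ≤ expect p f := by
  rw [← expect_indicator_one p hs, ← expect_const_mul]
  refine expect_mono fun x _ => ?_
  by_cases hx : x ∈ s
  · simpa [hx] using h x hx
  · simp [hx]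

end Expect

/-- The second moment about `c` is the variance plus the squared bias. A variable confined to an
interval of length 2 is within 2 of its mean, so its variance is at most 4. -/
theorem sum_mul_sq_sub_le {ι : Type*} (S : Finset ι) (w X : ι → ℝ) (A c : ℝ)
    (hw : ∀ i ∈ S, 0 ≤ w i) (hw1 : ∑ i ∈ S, w i = 1)
    (hX : ∀ i ∈ S, A ≤ X i ∧ X i ≤ A + 2) :
    ∑ i ∈ S, w i * (X i - c) ^ 2 ≤ 4 + (∑ i ∈ S, w i * X i - c) ^ 2 := by
  set m := ∑ i ∈ S, w i * X i with hm
  have hm1 : A ≤ m := by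
    calc A = ∑ i ∈ S, w i * A := by rw [← Finset.sum_mul, hw1, one_mul]
      _ ≤ m := Finset.sum_le_sum fun i hi => mul_le_mul_of_nonneg_left (hX i hi).1 (hw i hi)
  have hm2 : m ≤ A + 2 := by
    calc m ≤ ∑ i ∈ S, w i * (A + 2) :=
          Finset.sum_le_sum fun i hi => mul_le_mul_of_nonneg_left (hX i hi).2 (hw i hi)
      _ = A + 2 := by rw [← Finset.sum_mul, hw1, one_mul]
  have h1 : ∑ i ∈ S, w i * (X i - c) ^ 2
      = ∑ i ∈ S, w i * (X i - m) ^ 2 + (m - c) ^ 2 := by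
    have : ∀ i ∈ S, w i * (X i - c) ^ 2
        = w i * (X i - m) ^ 2 + 2 * (m - c) * (w i * X i) - 2 * (m - c) * m * w i
          + (m - c) ^ 2 * w i := fun i _ => by ring
    rw [Finset.sum_congr rfl this]
    simp only [Finset.sum_add_distrib, Finset.sum_sub_distrib, ← Finset.mul_sum, hw1, ← hm]
    ring
  have h2 : ∑ i ∈ S, w i * (X i - m) ^ 2 ≤ ∑ i ∈ S, w i * 4 := by
    refine Finset.sum_le_sum fun i hi => mul_le_mul_of_nonneg_left ?_ (hw i hi)
    have := hX i hi
    nlinarith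
  rw [← Finset.sum_mul, hw1] at h2
  linarith

/-! ### One step of the evolution -/

theorem vertexCount_succ (y : ℕ → Bool) (t : ℕ) :
    vertexCount y (t + 1) = vertexCount y t + if y (t + 1) then 1 else 0 := by
  unfold vertexCount
  rw [← Finset.insert_Icc_right_eq_Icc_add_one (by omega), Finset.filter_insert]
  split_ifs with h
  · rw [Finset.card_insert_of_notMem (by simp)]; ring
  · rfl

theorem vertexCount_zero (y : ℕ → Bool) : vertexCount y 0 = 1 := by simp [vertexCount]

theorem one_le_vertexCount (y : ℕ → Bool) (t : ℕ) : 1 ≤ vertexCount y t := by simp [vertexCount]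

theorem vertexCount_le (y : ℕ → Bool) (t : ℕ) : vertexCount y t ≤ t + 1 := by
  induction t with
  | zero => simp [vertexCount_zero]
  | succ t ih => rw [vertexCount_succ]; split_ifs <;> omega

/-- The total weight of the vertices of `G_t`. -/
noncomputable def totalWeight (y : ℕ → Bool) (a : ℝ) (t : ℕ) : ℝ :=
  2 * t + 1 + a * vertexCount y t

/-- The probability that a given leaf of `G_t` is chosen as a random vertex. -/
noncomputable def hitProb (y : ℕ → Bool) (a : ℝ) (t : ℕ) : ℝ := (1 + a) / totalWeight y a t

/-- The probability that a given leaf of `G_t` is still a leaf of `G_{t+1}`. -/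
noncomputable def keepProb (y : ℕ → Bool) (a : ℝ) (t : ℕ) : ℝ :=
  if y (t + 1) then 1 - hitProb y a t else (1 - hitProb y a t) ^ 2

/-- The expected number of leaves of `G_{t+1}` if `G_t` has `x` leaves. -/
noncomputable def stepMean (y : ℕ → Bool) (a : ℝ) (t : ℕ) (x : ℝ) : ℝ :=
  keepProb y a t * x + if y (t + 1) then 1 else 0

/-- For `a > -1` the first summand is nonnegative and the second positive, although `a` itself may
be negative. -/
theorem totalWeight_eq (y : ℕ → Bool) (a : ℝ) (t : ℕ) :
    totalWeight y a t = (2 * t + 1 - vertexCount y t) + (1 + a) * vertexCount y t := by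
  unfold totalWeight; ring

theorem vertexCount_le_real (y : ℕ → Bool) (t : ℕ) : (vertexCount y t : ℝ) ≤ t + 1 := by
  exact_mod_cast vertexCount_le y t

theorem one_le_vertexCount_real (y : ℕ → Bool) (t : ℕ) : (1 : ℝ) ≤ vertexCount y t := by
  exact_mod_cast one_le_vertexCount y t

theorem totalWeight_pos (y : ℕ → Bool) {a : ℝ} (ha : -1 < a) (t : ℕ) : 0 < totalWeight y a t := by
  rw [totalWeight_eq]
  have h1 := vertexCount_le_real y t
  have h2 := one_le_vertexCount_real y t
  have h3 : (0 : ℝ) ≤ t := t.cast_nonneg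
  have : 0 < (1 + a) * vertexCount y t := mul_pos (by linarith) (by linarith)
  linarith

theorem hitProb_nonneg (y : ℕ → Bool) {a : ℝ} (ha : -1 < a) (t : ℕ) : 0 ≤ hitProb y a t :=
  div_nonneg (by linarith) (totalWeight_pos y ha t).le

/-- Each of the vertices has weight at least `1 + a`. With linearly many vertices this makes the
hitting probability `O(1 / t)`. -/
theorem hitProb_mul_vertexCount_le (y : ℕ → Bool) {a : ℝ} (ha : -1 < a) (t : ℕ) :
    hitProb y a t * vertexCount y t ≤ 1 := by
  unfold hitProb
  rw [div_mul_eq_mul_div, div_le_one (totalWeight_pos y ha t), totalWeight_eq]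
  have h1 := vertexCount_le_real y t
  have h3 : (0 : ℝ) ≤ t := t.cast_nonneg
  linarith

theorem hitProb_le_one (y : ℕ → Bool) {a : ℝ} (ha : -1 < a) (t : ℕ) : hitProb y a t ≤ 1 := by
  nlinarith [hitProb_mul_vertexCount_le y ha t, one_le_vertexCount_real y t, hitProb_nonneg y ha t]

theorem keepProb_nonneg (y : ℕ → Bool) {a : ℝ} (ha : -1 < a) (t : ℕ) : 0 ≤ keepProb y a t := by
  unfold keepProb
  split_ifs
  · linarith [hitProb_le_one y ha t]
  · positivity

theorem keepProb_le_one (y : ℕ → Bool) {a : ℝ} (ha : -1 < a) (t : ℕ) : keepProb y a t ≤ 1 := by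
  unfold keepProb
  split_ifs
  · linarith [hitProb_nonneg y ha t]
  · nlinarith [hitProb_nonneg y ha t, hitProb_le_one y ha t]

theorem one_sub_two_mul_hitProb_le (y : ℕ → Bool) {a : ℝ} (ha : -1 < a) (t : ℕ) :
    1 - 2 * hitProb y a t ≤ keepProb y a t := by
  unfold keepProb
  split_ifs
  · linarith [hitProb_nonneg y ha t]
  · nlinarith [sq_nonneg (hitProb y a t)]

/-! ### Degrees and leaves of the graphs that can occur -/

namespace Network

theorem degree_cons (n m : ℕ) (e : ℕ × ℕ) (l : List (ℕ × ℕ)) (u : ℕ) :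
    degree ⟨n, e :: l⟩ u =
      degree ⟨m, l⟩ u + ((if e.1 = u then 1 else 0) + (if e.2 = u then 1 else 0)) := by
  simp only [degree, List.map_cons, List.sum_cons]; omega

/-- The properties shared by all graphs that can occur as `G_t`. -/
structure WellFormed (y : ℕ → Bool) (t : ℕ) (g : Network) : Prop where
  verts_eq : g.verts = vertexCount y t
  sum_degree : ∑ u ∈ Finset.range g.verts, g.degree u = 2 * t + 1
  one_le_degree : ∀ u < g.verts, 1 ≤ g.degree u
  degree_eq_zero : ∀ u, g.verts ≤ u → g.degree u = 0

theorem wellFormed_initial (y : ℕ → Bool) : WellFormed y 0 initial where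
  verts_eq := by simp [initial, vertexCount_zero]
  sum_degree := by simp [initial, degree]
  one_le_degree u hu := by
    have : u = 0 := by simpa [initial] using hu
    simp [initial, degree, this]
  degree_eq_zero u hu := by
    have : u ≠ 0 := by simp [initial] at hu; omega
    simp [initial, degree, this]

theorem leaves_initial : initial.leaves = 1 := by
  simp [leaves, initial, degree]

theorem WellFormed.vertexStep {y : ℕ → Bool} {t : ℕ} {g : Network} (h : WellFormed y t g)
    (hy : y (t + 1) = true) {u : ℕ} (hu : u < g.verts) :
    WellFormed y (t + 1) ⟨g.verts + 1, (g.verts, u) :: g.edges⟩ where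
  verts_eq := by simp [vertexCount_succ, hy, h.verts_eq]
  sum_degree := by
    simp only [degree_cons _ g.verts, Finset.sum_add_distrib, Finset.sum_ite_eq]
    rw [Finset.sum_range_succ]
    have h1 := h.sum_degree
    have h2 := h.degree_eq_zero g.verts le_rfl
    simp only [Finset.mem_range]
    rw [if_pos (by omega), if_pos (by omega)]
    change ∑ u ∈ Finset.range g.verts, g.degree u + g.degree g.verts + _ = _
    omega
  one_le_degree v hv := by
    rw [degree_cons _ g.verts]
    change v < g.verts + 1 at hv
    change 1 ≤ g.degree v + _
    rcases Nat.lt_succ_iff_lt_or_eq.1 hv with hv | hv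
    · have := h.one_le_degree v hv; omega
    · subst hv; simp only [if_true]; omega
  degree_eq_zero v hv := by
    rw [degree_cons _ g.verts]
    change g.verts + 1 ≤ v at hv
    change g.degree v + _ = 0
    rw [h.degree_eq_zero v (by omega), if_neg (by simp only; omega), if_neg (by simp only; omega)]

theorem WellFormed.edgeStep {y : ℕ → Bool} {t : ℕ} {g : Network} (h : WellFormed y t g)
    (hy : y (t + 1) = false) {u w : ℕ} (hu : u < g.verts) (hw : w < g.verts) :
    WellFormed y (t + 1) ⟨g.verts, (u, w) :: g.edges⟩ where
  verts_eq := by simp [vertexCount_succ, hy, h.verts_eq]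
  sum_degree := by
    simp only [degree_cons _ g.verts, Finset.sum_add_distrib, Finset.sum_ite_eq]
    have h1 := h.sum_degree
    simp only [Finset.mem_range]
    rw [if_pos hu, if_pos hw]
    change ∑ u ∈ Finset.range g.verts, g.degree u + _ = _
    omega
  one_le_degree v hv := by
    rw [degree_cons _ g.verts]
    exact (h.one_le_degree v hv).trans (Nat.le_add_right _ _)
  degree_eq_zero v hv := by
    rw [degree_cons _ g.verts]
    change g.verts ≤ v at hv
    change g.degree v + _ = 0
    rw [h.degree_eq_zero v hv, if_neg (by simp only; omega), if_neg (by simp only; omega)]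

/-- The indicator of the leaves, as a real number. -/
noncomputable def leafInd (g : Network) (u : ℕ) : ℝ := if g.degree u = 1 then 1 else 0

theorem leafInd_nonneg (g : Network) (u : ℕ) : 0 ≤ g.leafInd u := by
  unfold leafInd; split_ifs <;> norm_num

theorem leafInd_le_one (g : Network) (u : ℕ) : g.leafInd u ≤ 1 := by
  unfold leafInd; split_ifs <;> norm_num

theorem cast_leaves (g : Network) : (g.leaves : ℝ) = ∑ u ∈ Finset.range g.verts, g.leafInd u := by
  simp [leaves, leafInd]

theorem leaves_vertexStep {y : ℕ → Bool} {t : ℕ} {g : Network} (h : WellFormed y t g) {u : ℕ}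
    (hu : u < g.verts) :
    ((⟨g.verts + 1, (g.verts, u) :: g.edges⟩ : Network).leaves : ℝ) =
      g.leaves + 1 - g.leafInd u := by
  rw [cast_leaves, cast_leaves]
  change ∑ v ∈ Finset.range (g.verts + 1), _ = _
  rw [Finset.sum_range_succ]
  have h1 : ∀ v ∈ Finset.range g.verts,
      leafInd ⟨g.verts + 1, (g.verts, u) :: g.edges⟩ v =
        g.leafInd v - if u = v then g.leafInd v else 0 := by
    intro v hv
    have hv := Finset.mem_range.1 hv
    have := h.one_le_degree v hv
    unfold leafInd
    rw [degree_cons _ g.verts]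
    change (if g.degree v + _ = 1 then (1 : ℝ) else 0) = _
    rw [if_neg (show ¬ (g.verts, u).1 = v by simp only; omega)]
    by_cases huv : u = v
    · rw [if_pos (show (g.verts, u).2 = v from huv), if_pos huv, if_neg (by omega)]; ring
    · rw [if_neg (show ¬ (g.verts, u).2 = v from huv), if_neg huv]; simp
  rw [Finset.sum_congr rfl h1, Finset.sum_sub_distrib, Finset.sum_ite_eq,
    if_pos (Finset.mem_range.2 hu)]
  have h2 : leafInd ⟨g.verts + 1, (g.verts, u) :: g.edges⟩ g.verts = 1 := by
    unfold leafInd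
    rw [degree_cons _ g.verts]
    change (if g.degree g.verts + _ = 1 then (1 : ℝ) else 0) = _
    rw [h.degree_eq_zero _ le_rfl, if_neg (show ¬ (g.verts, u).2 = g.verts by simp only; omega)]
    simp
  rw [h2]; ring

/-- A loop at a leaf destroys only one leaf, whence the correction for `u = w`. -/
theorem leaves_edgeStep {y : ℕ → Bool} {t : ℕ} {g : Network} (h : WellFormed y t g) {u w : ℕ}
    (hu : u < g.verts) (hw : w < g.verts) :
    ((⟨g.verts, (u, w) :: g.edges⟩ : Network).leaves : ℝ) =
      g.leaves - g.leafInd u - g.leafInd w + if u = w then g.leafInd u else 0 := by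
  rw [cast_leaves, cast_leaves]
  change ∑ v ∈ Finset.range g.verts, _ = _
  -- Every correction is written as a term supported at a single `v`, so that `Finset.sum_ite_eq`
  -- evaluates the sum.
  have h1 : ∀ v ∈ Finset.range g.verts,
      leafInd ⟨g.verts, (u, w) :: g.edges⟩ v =
        g.leafInd v - (if u = v then g.leafInd v else 0) - (if w = v then g.leafInd v else 0)
          + if u = v then (if u = w then g.leafInd v else 0) else 0 := by
    intro v hv
    have hv := Finset.mem_range.1 hv
    have := h.one_le_degree v hv
    unfold leafInd
    rw [degree_cons _ g.verts]
    change (if g.degree v + ((if u = v then 1 else 0) + if w = v then 1 else 0) = 1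
      then (1 : ℝ) else 0) = _
    by_cases huv : u = v <;> by_cases hwv : w = v
    · have : u = w := huv.trans hwv.symm
      simp only [if_pos huv, if_pos hwv, if_pos this]
      rw [if_neg (by omega)]; ring
    · have : u ≠ w := fun e => hwv (e ▸ huv)
      simp only [if_pos huv, if_neg hwv, if_neg this]
      rw [if_neg (by omega)]; ring
    · simp only [if_neg huv, if_pos hwv]
      rw [if_neg (by omega)]; ring
    · simp only [if_neg huv, if_neg hwv]
      simp
  rw [Finset.sum_congr rfl h1]
  simp only [Finset.sum_sub_distrib, Finset.sum_add_distrib, Finset.sum_ite_eq,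
    if_pos (Finset.mem_range.2 hu), if_pos (Finset.mem_range.2 hw)]

/-! ### The random vertex and the leaf count after one step -/

/-- The probability that `u` is the random vertex, as a real number. -/
noncomputable def vertexProb (y : ℕ → Bool) (a : ℝ) (t : ℕ) (g : Network) (u : ℕ) : ℝ :=
  (g.degree u + a) / totalWeight y a t

variable {y : ℕ → Bool} {t : ℕ} {g : Network} {a : ℝ}

theorem WellFormed.degree_add_pos (h : WellFormed y t g) (ha : -1 < a) {u : ℕ}
    (hu : u < g.verts) : 0 < (g.degree u : ℝ) + a := by
  have : (1 : ℝ) ≤ g.degree u := by exact_mod_cast h.one_le_degree u hu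
  linarith

theorem WellFormed.sum_degree_add (h : WellFormed y t g) :
    ∑ u ∈ Finset.range g.verts, ((g.degree u : ℝ) + a) = totalWeight y a t := by
  rw [Finset.sum_add_distrib, ← Nat.cast_sum, h.sum_degree, Finset.sum_const, Finset.card_range,
    h.verts_eq, totalWeight]
  push_cast
  ring

theorem WellFormed.tsum_weight (h : WellFormed y t g) (ha : -1 < a) :
    ∑' u, g.weight a u = ENNReal.ofReal (totalWeight y a t) := by
  rw [tsum_eq_sum (s := Finset.range g.verts)
    (fun u hu => by simp only [Finset.mem_range] at hu; simp [weight, hu])]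
  rw [← h.sum_degree_add, ENNReal.ofReal_sum_of_nonneg
    fun u hu => (h.degree_add_pos ha (Finset.mem_range.1 hu)).le]
  refine Finset.sum_congr rfl fun u hu => ?_
  simp [weight, Finset.mem_range.1 hu]

theorem WellFormed.randomVertex_apply (h : WellFormed y t g) (ha : -1 < a) (u : ℕ) :
    g.randomVertex a u =
      if u < g.verts then ENNReal.ofReal (vertexProb y a t g u) else 0 := by
  have hW := totalWeight_pos y ha t
  have hne : ∑' u, g.weight a u ≠ 0 := by
    rw [h.tsum_weight ha]; simpa using hW
  unfold randomVertex
  rw [dif_pos hne, PMF.normalize_apply, h.tsum_weight ha, weight]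
  split_ifs
  · rw [vertexProb, ENNReal.ofReal_div_of_pos hW, div_eq_mul_inv]
  · simp

theorem WellFormed.expect_randomVertex (h : WellFormed y t g) (ha : -1 < a) (f : ℕ → ENNReal) :
    expect (g.randomVertex a) f =
      ∑ u ∈ Finset.range g.verts, ENNReal.ofReal (vertexProb y a t g u) * f u := by
  unfold expect
  rw [tsum_eq_sum (s := Finset.range g.verts)
    (fun u hu => by rw [h.randomVertex_apply ha]; simp only [Finset.mem_range] at hu; simp [hu])]
  refine Finset.sum_congr rfl fun u hu => ?_
  rw [h.randomVertex_apply ha, if_pos (Finset.mem_range.1 hu)]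

theorem WellFormed.support_randomVertex (h : WellFormed y t g) (ha : -1 < a) :
    (g.randomVertex a).support = {u | u < g.verts} := by
  ext u
  rw [PMF.mem_support_iff, h.randomVertex_apply ha]
  by_cases hu : u < g.verts
  · have : 0 < vertexProb y a t g u := div_pos (h.degree_add_pos ha hu) (totalWeight_pos y ha t)
    simp [hu, this]
  · simp [hu]

theorem WellFormed.vertexProb_nonneg (h : WellFormed y t g) (ha : -1 < a) {u : ℕ}
    (hu : u ∈ Finset.range g.verts) : 0 ≤ vertexProb y a t g u :=
  div_nonneg (h.degree_add_pos ha (Finset.mem_range.1 hu)).le (totalWeight_pos y ha t).le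

theorem WellFormed.sum_vertexProb (h : WellFormed y t g) (ha : -1 < a) :
    ∑ u ∈ Finset.range g.verts, vertexProb y a t g u = 1 := by
  simp only [vertexProb, ← Finset.sum_div, h.sum_degree_add]
  exact div_self (totalWeight_pos y ha t).ne'

/-- All leaves are equally likely to be chosen, with a probability not depending on the rest of the
graph. This closes the recursion of the mean in the leaf count alone. -/
theorem vertexProb_mul_leafInd (u : ℕ) :
    vertexProb y a t g u * g.leafInd u = hitProb y a t * g.leafInd u := by
  unfold vertexProb hitProb leafInd
  split_ifs with hu
  · rw [hu]; simp
  · simp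

theorem sum_vertexProb_mul_leafInd :
    ∑ u ∈ Finset.range g.verts, vertexProb y a t g u * g.leafInd u =
      hitProb y a t * g.leaves := by
  rw [cast_leaves, Finset.mul_sum]
  exact Finset.sum_congr rfl fun u _ => vertexProb_mul_leafInd u

/-- The expectation of a nonnegative function of the number of leaves after one step. -/
theorem WellFormed.expect_step (h : WellFormed y t g) (ha : -1 < a) :
    ∃ (S : Finset (ℕ × ℕ)) (w X : ℕ × ℕ → ℝ) (A : ℝ), (∀ i ∈ S, 0 ≤ w i) ∧ ∑ i ∈ S, w i = 1 ∧
      (∀ i ∈ S, A ≤ X i ∧ X i ≤ A + 2) ∧ (∀ i ∈ S, 0 ≤ X i) ∧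
      ∑ i ∈ S, w i * X i = stepMean y a t g.leaves ∧
      ∀ f : ℝ → ℝ, (∀ i ∈ S, 0 ≤ f (X i)) →
        (expect (step (y (t + 1)) a g) fun g' => ENNReal.ofReal (f g'.leaves)) =
          ENNReal.ofReal (∑ i ∈ S, w i * f (X i)) := by
  have hP := fun u hu => h.vertexProb_nonneg (a := a) ha (u := u) hu
  have hP1 := h.sum_vertexProb (a := a) ha
  have hPL : ∑ u ∈ Finset.range g.verts, vertexProb y a t g u * g.leafInd u =
      hitProb y a t * g.leaves := sum_vertexProb_mul_leafInd
  cases hy : y (t + 1)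
  · refine ⟨Finset.range g.verts ×ˢ Finset.range g.verts,
      fun i => vertexProb y a t g i.1 * vertexProb y a t g i.2,
      fun i => g.leaves - g.leafInd i.1 - g.leafInd i.2 + if i.1 = i.2 then g.leafInd i.1 else 0,
      g.leaves - 2, ?_, ?_, ?_, ?_, ?_, ?_⟩
    · rintro ⟨u, w⟩ hi
      rw [Finset.mem_product] at hi
      exact mul_nonneg (hP _ hi.1) (hP _ hi.2)
    · rw [Finset.sum_product]
      simp only [← Finset.mul_sum, hP1, mul_one]
    · rintro ⟨u, w⟩ -
      have h1 := g.leafInd_nonneg u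
      have h2 := g.leafInd_nonneg w
      have h3 := g.leafInd_le_one u
      have h4 := g.leafInd_le_one w
      simp only
      split_ifs with huw
      · subst huw; constructor <;> linarith
      · constructor <;> linarith
    · rintro ⟨u, w⟩ hi
      simp only [Finset.mem_product, Finset.mem_range] at hi
      have := leaves_edgeStep h hi.1 hi.2
      simp only
      rw [← this]
      exact Nat.cast_nonneg _
    · rw [Finset.sum_product]
      -- With `π` the hitting probability and `L` the leaf count, the two ends remove `2πL` on
      -- average and the loop correction returns `π²L`, which gives `(1 - π)²L`.
      have h1 : ∀ u ∈ Finset.range g.verts, ∑ w ∈ Finset.range g.verts,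
          vertexProb y a t g u * vertexProb y a t g w *
            (g.leaves - g.leafInd u - g.leafInd w + if u = w then g.leafInd u else 0) =
          (g.leaves - hitProb y a t * g.leaves) * vertexProb y a t g u
            - (1 - hitProb y a t) * (vertexProb y a t g u * g.leafInd u) := by
        intro u hu
        have h2 : ∀ w ∈ Finset.range g.verts, vertexProb y a t g u * vertexProb y a t g w *
            (g.leaves - g.leafInd u - g.leafInd w + if u = w then g.leafInd u else 0) =
            vertexProb y a t g u * (g.leaves - g.leafInd u) * vertexProb y a t g w
            - vertexProb y a t g u * (vertexProb y a t g w * g.leafInd w)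
            + vertexProb y a t g u *
              (if u = w then vertexProb y a t g w * g.leafInd w else 0) := by
          intro w _
          split_ifs with huw
          · subst huw; ring
          · ring
        rw [Finset.sum_congr rfl h2, Finset.sum_add_distrib, Finset.sum_sub_distrib,
          ← Finset.mul_sum, ← Finset.mul_sum, ← Finset.mul_sum, hP1, hPL, Finset.sum_ite_eq,
          if_pos hu, vertexProb_mul_leafInd]
        have := vertexProb_mul_leafInd (y := y) (t := t) (g := g) (a := a) u
        linear_combination (hitProb y a t - 1) * this
      rw [Finset.sum_congr rfl h1, Finset.sum_sub_distrib, ← Finset.mul_sum, ← Finset.mul_sum, hP1,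
        hPL]
      simp only [stepMean, keepProb, hy]
      simp
      ring
    · intro f hf
      simp only [step, Bool.false_eq_true, if_false]
      rw [expect_bind]
      simp only [expect_map]
      rw [h.expect_randomVertex ha, Finset.sum_product, ENNReal.ofReal_sum_of_nonneg]
      · refine Finset.sum_congr rfl fun u hu => ?_
        rw [h.expect_randomVertex ha, Finset.mul_sum, ENNReal.ofReal_sum_of_nonneg]
        · refine Finset.sum_congr rfl fun w hw => ?_
          rw [leaves_edgeStep h (Finset.mem_range.1 hu) (Finset.mem_range.1 hw),
            ENNReal.ofReal_mul (mul_nonneg (hP _ hu) (hP _ hw)), ENNReal.ofReal_mul (hP _ hu),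
            mul_assoc]
        · intro w hw
          exact mul_nonneg (mul_nonneg (hP _ hu) (hP _ hw)) (hf (u, w) (Finset.mk_mem_product hu hw))
      · intro u hu
        refine Finset.sum_nonneg fun w hw => ?_
        exact mul_nonneg (mul_nonneg (hP _ hu) (hP _ hw)) (hf (u, w) (Finset.mk_mem_product hu hw))
  -- Only one vertex is chosen here; the second coordinate is a dummy that matches the index type of
  -- the edge-step.
  · refine ⟨Finset.range g.verts ×ˢ {0},
      fun i => vertexProb y a t g i.1, fun i => g.leaves + 1 - g.leafInd i.1,
      g.leaves - 1, ?_, ?_, ?_, ?_, ?_, ?_⟩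
    · rintro ⟨u, w⟩ hi
      rw [Finset.mem_product] at hi
      exact hP _ hi.1
    · rw [Finset.sum_product]
      simpa using hP1
    · rintro ⟨u, w⟩ -
      have h1 := g.leafInd_nonneg u
      have h3 := g.leafInd_le_one u
      simp only
      constructor <;> linarith
    · rintro ⟨u, w⟩ hi
      have h3 := g.leafInd_le_one u
      have : (0 : ℝ) ≤ g.leaves := Nat.cast_nonneg _
      simp only
      linarith
    · rw [Finset.sum_product]
      simp only [Finset.sum_singleton]
      have h1 : ∀ u ∈ Finset.range g.verts,
          vertexProb y a t g u * (g.leaves + 1 - g.leafInd u) =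
          (g.leaves + 1) * vertexProb y a t g u - vertexProb y a t g u * g.leafInd u :=
        fun u _ => by ring
      rw [Finset.sum_congr rfl h1, Finset.sum_sub_distrib, ← Finset.mul_sum, hP1, hPL]
      simp only [stepMean, keepProb, hy, if_true]
      ring
    · intro f hf
      simp only [step, if_true]
      rw [expect_map, h.expect_randomVertex ha, Finset.sum_product, ENNReal.ofReal_sum_of_nonneg]
      · refine Finset.sum_congr rfl fun u hu => ?_
        rw [leaves_vertexStep h (Finset.mem_range.1 hu), Finset.sum_singleton,
          ENNReal.ofReal_mul (hP _ hu)]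
      · intro u hu
        rw [Finset.sum_singleton]
        exact mul_nonneg (hP _ hu) (hf (u, 0) (Finset.mk_mem_product hu (by simp)))

theorem WellFormed.expect_step_leaves (h : WellFormed y t g) (ha : -1 < a) :
    (expect (step (y (t + 1)) a g) fun g' => ENNReal.ofReal g'.leaves) =
      ENNReal.ofReal (stepMean y a t g.leaves) := by
  obtain ⟨S, w, X, A, -, -, -, hX0, hm, hf⟩ := h.expect_step ha
  have := hf id hX0
  simp only [id] at this
  rw [this, hm]

theorem WellFormed.expect_step_sq_le (h : WellFormed y t g) (ha : -1 < a) (c : ℝ) :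
    (expect (step (y (t + 1)) a g) fun g' => ENNReal.ofReal (((g'.leaves : ℝ) - c) ^ 2)) ≤
      ENNReal.ofReal (4 + (stepMean y a t g.leaves - c) ^ 2) := by
  obtain ⟨S, w, X, A, hw, hw1, hX, -, hm, hf⟩ := h.expect_step ha
  rw [hf (fun x => (x - c) ^ 2) fun i _ => sq_nonneg _, ← hm]
  exact ENNReal.ofReal_le_ofReal (sum_mul_sq_sub_le S w X A c hw hw1 hX)

/-- The right-hand side does not involve `a`: a history observed under one parameter is possible
under every other, so conditioning on it is never degenerate. -/
theorem mem_support_step (h : WellFormed y t g) (ha : -1 < a) {g' : Network} :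
    g' ∈ (step (y (t + 1)) a g).support ↔
      (y (t + 1) = true ∧ ∃ u < g.verts, g' = ⟨g.verts + 1, (g.verts, u) :: g.edges⟩) ∨
      (y (t + 1) = false ∧ ∃ u < g.verts, ∃ w < g.verts, g' = ⟨g.verts, (u, w) :: g.edges⟩) := by
  cases hy : y (t + 1)
  · simp only [step, Bool.false_eq_true, if_false, PMF.mem_support_bind_iff,
      PMF.mem_support_map_iff, h.support_randomVertex ha, Set.mem_ofPred_eq, false_and, false_or,
      true_and, eq_comm (a := g')]
  · simp only [step, if_true, PMF.mem_support_map_iff, h.support_randomVertex ha,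
      Set.mem_ofPred_eq, true_and, reduceCtorEq, false_and, or_false, eq_comm (a := g')]

theorem WellFormed.of_mem_support_step (h : WellFormed y t g) (ha : -1 < a) {g' : Network}
    (hg : g' ∈ (step (y (t + 1)) a g).support) : WellFormed y (t + 1) g' := by
  rcases (mem_support_step h ha).1 hg with ⟨hy, u, hu, rfl⟩ | ⟨hy, u, hu, w, hw, rfl⟩
  · exact h.vertexStep hy hu
  · exact h.edgeStep hy hu hw

theorem WellFormed.abs_leaves_sub_le (h : WellFormed y t g) (ha : -1 < a) {g' : Network}
    (hg : g' ∈ (step (y (t + 1)) a g).support) : |(g'.leaves : ℝ) - g.leaves| ≤ 2 := by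
  rcases (mem_support_step h ha).1 hg with ⟨hy, u, hu, rfl⟩ | ⟨hy, u, hu, w, hw, rfl⟩
  · rw [leaves_vertexStep h hu, abs_le]
    have h1 := g.leafInd_nonneg u
    have h3 := g.leafInd_le_one u
    constructor <;> linarith
  · rw [leaves_edgeStep h hu hw, abs_le]
    have h1 := g.leafInd_nonneg u
    have h2 := g.leafInd_nonneg w
    have h3 := g.leafInd_le_one u
    have h4 := g.leafInd_le_one w
    split_ifs <;> constructor <;> linarith

end Network

/-! ### The recursion of the mean -/

/-- The expected number of leaves at time `t`, if there are `w` leaves at all times up to `t₀` and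
the steps after time `t₀` use the parameters `a`. -/
noncomputable def meanFrom (y : ℕ → Bool) (t₀ : ℕ) (w : ℝ) (a : ℕ → ℝ) : ℕ → ℝ
  | 0 => w
  | t + 1 => if t + 1 ≤ t₀ then w else stepMean y (a (t + 1)) t (meanFrom y t₀ w a t)

/-- The expected number of leaves of `G_t` in the model with the parameters `a`. -/
noncomputable def meanLeaves (y : ℕ → Bool) (a : ℕ → ℝ) (t : ℕ) : ℝ := meanFrom y 0 1 a t

theorem meanFrom_of_le (y : ℕ → Bool) {t₀ t : ℕ} (w : ℝ) (a : ℕ → ℝ) (h : t ≤ t₀) :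
    meanFrom y t₀ w a t = w := by
  cases t with
  | zero => rfl
  | succ t => rw [meanFrom, if_pos h]

theorem meanFrom_succ (y : ℕ → Bool) {t₀ t : ℕ} (w : ℝ) (a : ℕ → ℝ) (h : t₀ ≤ t) :
    meanFrom y t₀ w a (t + 1) = stepMean y (a (t + 1)) t (meanFrom y t₀ w a t) := by
  rw [meanFrom, if_neg (by omega)]

theorem meanLeaves_zero (y : ℕ → Bool) (a : ℕ → ℝ) : meanLeaves y a 0 = 1 := rfl

theorem meanLeaves_succ (y : ℕ → Bool) (a : ℕ → ℝ) (t : ℕ) :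
    meanLeaves y a (t + 1) = stepMean y (a (t + 1)) t (meanLeaves y a t) :=
  meanFrom_succ y 1 a (Nat.zero_le t)

theorem stepMean_nonneg (y : ℕ → Bool) {a : ℝ} (ha : -1 < a) (t : ℕ) {x : ℝ} (hx : 0 ≤ x) :
    0 ≤ stepMean y a t x := by
  have := mul_nonneg (keepProb_nonneg y ha t) hx
  unfold stepMean
  split_ifs <;> linarith

theorem meanFrom_nonneg (y : ℕ → Bool) (t₀ : ℕ) {w : ℝ} {a : ℕ → ℝ} (ha : ∀ t, -1 < a t)
    (hw : 0 ≤ w) (t : ℕ) : 0 ≤ meanFrom y t₀ w a t := by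
  induction t with
  | zero => exact hw
  | succ t ih =>
    rw [meanFrom]
    split_ifs
    · exact hw
    · exact stepMean_nonneg y (ha _) t ih

theorem meanLeaves_nonneg (y : ℕ → Bool) {a : ℕ → ℝ} (ha : ∀ t, -1 < a t) (t : ℕ) :
    0 ≤ meanLeaves y a t := meanFrom_nonneg y 0 ha zero_le_one t

theorem meanLeaves_le (y : ℕ → Bool) {a : ℕ → ℝ} (ha : ∀ t, -1 < a t) (t : ℕ) :
    meanLeaves y a t ≤ vertexCount y t := by
  induction t with
  | zero => simp [meanLeaves_zero, vertexCount_zero]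
  | succ t ih =>
    rw [meanLeaves_succ, stepMean, vertexCount_succ]
    have h0 := meanLeaves_nonneg y ha t
    have := mul_le_of_le_one_left h0 (keepProb_le_one y (ha (t + 1)) t)
    push_cast
    gcongr
    linarith

/-- The mean is at most the number of vertices, so at most two leaves are lost on average, and at
most one is gained. -/
theorem abs_meanLeaves_succ_sub_le (y : ℕ → Bool) {a : ℕ → ℝ} (ha : ∀ t, -1 < a t) (t : ℕ) :
    |meanLeaves y a (t + 1) - meanLeaves y a t| ≤ 2 := by
  rw [meanLeaves_succ, stepMean]
  have h0 := meanLeaves_nonneg y ha t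
  have h1 := meanLeaves_le y ha t
  have h2 := keepProb_le_one y (ha (t + 1)) t
  have h3 := one_sub_two_mul_hitProb_le y (ha (t + 1)) t
  have h4 := hitProb_mul_vertexCount_le y (ha (t + 1)) t
  have h5 := hitProb_nonneg y (ha (t + 1)) t
  have h6 : (1 - keepProb y (a (t + 1)) t) * meanLeaves y a t ≤ 2 := by
    calc _ ≤ (2 * hitProb y (a (t + 1)) t) * vertexCount y t := by gcongr; linarith
      _ ≤ 2 := by linarith
  have h7 : 0 ≤ (1 - keepProb y (a (t + 1)) t) * meanLeaves y a t :=
    mul_nonneg (by linarith) h0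
  rw [abs_le]
  split_ifs <;> constructor <;> linarith

theorem abs_sub_le_two_mul_of_succ {T : ℕ} {f : ℕ → ℝ} (h : ∀ t < T, |f (t + 1) - f t| ≤ 2)
    {s t : ℕ} (hst : s ≤ t) (ht : t ≤ T) : |f t - f s| ≤ 2 * (t - s) := by
  induction t, hst using Nat.le_induction with
  | base => simp
  | succ t hst ih =>
    have h1 := h t (by omega)
    have h2 := ih (by omega)
    have := abs_sub_le (f (t + 1)) (f t) (f s)
    push_cast
    linarith

/-! ### The law of the trajectories -/

/-- The trajectory that follows `G` up to time `T` and stays at `g` afterwards. -/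
def Trajectory.extend (T : ℕ) (G : Trajectory) (g : Network) : Trajectory :=
  fun i => if i ≤ T then G i else g

theorem Trajectory.extend_of_le {T i : ℕ} (G : Trajectory) (g : Network) (h : i ≤ T) :
    G.extend T g i = G i := if_pos h

theorem Trajectory.extend_succ (T : ℕ) (G : Trajectory) (g : Network) :
    G.extend T g (T + 1) = g := if_neg (by omega)

section Trajectories

variable {y : ℕ → Bool} {a b : ℕ → ℝ}

theorem trajectoryLaw_succ (y : ℕ → Bool) (a : ℕ → ℝ) (T : ℕ) :
    trajectoryLaw y a (T + 1) = (trajectoryLaw y a T).bind fun G =>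
      (Network.step (y (T + 1)) (a (T + 1)) (G T)).map fun g => G.extend T g := rfl

theorem mem_support_trajectoryLaw_succ {T : ℕ} {G : Trajectory} :
    G ∈ (trajectoryLaw y a (T + 1)).support ↔ ∃ G' ∈ (trajectoryLaw y a T).support,
      ∃ g ∈ (Network.step (y (T + 1)) (a (T + 1)) (G' T)).support, G'.extend T g = G := by
  simp only [trajectoryLaw_succ, PMF.mem_support_bind_iff, PMF.mem_support_map_iff]

theorem wellFormed_of_mem_support (ha : ∀ t, -1 < a t) {T t : ℕ} (ht : t ≤ T) {G : Trajectory}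
    (hG : G ∈ (trajectoryLaw y a T).support) : (G t).WellFormed y t := by
  induction T generalizing G t with
  | zero =>
    obtain rfl : t = 0 := by omega
    have : G = fun _ => Network.initial := (PMF.mem_support_pure_iff _ _).1 hG
    rw [this]
    exact Network.wellFormed_initial y
  | succ T ih =>
    obtain ⟨G', hG', g, hg, rfl⟩ := mem_support_trajectoryLaw_succ.1 hG
    rcases Nat.le_succ_iff.1 ht with h | rfl
    · rw [Trajectory.extend_of_le _ _ h]
      exact ih h hG'
    · rw [Trajectory.extend_succ]
      exact (ih le_rfl hG').of_mem_support_step (ha _) hg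

/-- All parameters give rise to the same possible trajectories. -/
theorem support_trajectoryLaw_subset (ha : ∀ t, -1 < a t) (hb : ∀ t, -1 < b t) (T : ℕ) :
    (trajectoryLaw y a T).support ⊆ (trajectoryLaw y b T).support := by
  induction T with
  | zero => exact subset_rfl
  | succ T ih =>
    intro G hG
    obtain ⟨G', hG', g, hg, rfl⟩ := mem_support_trajectoryLaw_succ.1 hG
    have hw := wellFormed_of_mem_support ha le_rfl hG'
    refine mem_support_trajectoryLaw_succ.2 ⟨G', ih hG', g, ?_, rfl⟩
    rw [Network.mem_support_step hw (hb _)]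
    rwa [Network.mem_support_step hw (ha _)] at hg

theorem leafCount_zero_of_mem_support {T : ℕ} {G : Trajectory}
    (hG : G ∈ (trajectoryLaw y a T).support) : leafCount G 0 = 1 := by
  induction T generalizing G with
  | zero =>
    have : G = fun _ => Network.initial := (PMF.mem_support_pure_iff _ _).1 hG
    rw [this]
    exact Network.leaves_initial
  | succ T ih =>
    obtain ⟨G', hG', g, hg, rfl⟩ := mem_support_trajectoryLaw_succ.1 hG
    rw [← ih hG']
    rfl

theorem abs_leafCount_succ_sub_le (ha : ∀ t, -1 < a t) {T t : ℕ} (ht : t < T) {G : Trajectory}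
    (hG : G ∈ (trajectoryLaw y a T).support) :
    |(leafCount G (t + 1) : ℝ) - leafCount G t| ≤ 2 := by
  induction T generalizing G t with
  | zero => omega
  | succ T ih =>
    obtain ⟨G', hG', g, hg, rfl⟩ := mem_support_trajectoryLaw_succ.1 hG
    rcases Nat.lt_succ_iff_lt_or_eq.1 ht with h | rfl
    · have := ih h hG'
      unfold leafCount at this ⊢
      rwa [Trajectory.extend_of_le _ _ h, Trajectory.extend_of_le _ _ h.le]
    · unfold leafCount
      rw [Trajectory.extend_succ, Trajectory.extend_of_le _ _ le_rfl]
      exact (wellFormed_of_mem_support ha le_rfl hG').abs_leaves_sub_le (ha _) hg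

theorem expect_trajectoryLaw_succ (y : ℕ → Bool) (a : ℕ → ℝ) (T : ℕ) (Φ : Trajectory → ENNReal) :
    expect (trajectoryLaw y a (T + 1)) Φ = expect (trajectoryLaw y a T) fun G =>
      expect (Network.step (y (T + 1)) (a (T + 1)) (G T)) fun g => Φ (G.extend T g) := by
  rw [trajectoryLaw_succ, expect_bind]
  simp only [expect_map]

/-- The expectation of a function of `G_0, …, G_t` is the same at all times `T ≥ t`. -/
theorem expect_trajectoryLaw_of_le (y : ℕ → Bool) (a : ℕ → ℝ) {t T : ℕ} (htT : t ≤ T)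
    {Φ : Trajectory → ENNReal}
    (hΦ : ∀ G G' : Trajectory, (∀ i ≤ t, G i = G' i) → Φ G = Φ G') :
    expect (trajectoryLaw y a T) Φ = expect (trajectoryLaw y a t) Φ := by
  induction T, htT using Nat.le_induction with
  | base => rfl
  | succ T hT ih =>
    rw [expect_trajectoryLaw_succ, ← ih]
    refine expect_congr fun G _ => ?_
    have : ∀ g, Φ (G.extend T g) = Φ G := fun g =>
      hΦ _ _ fun i hi => Trajectory.extend_of_le _ _ (hi.trans hT)
    simp only [this, expect_const]

theorem measurableSet_trajectory (s : Set Trajectory) : MeasurableSet s := trivial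

/-- The event that the leaf counts up to time `t` are `x`. -/
def observed (t : ℕ) (x : ℕ → ℕ) : Set Trajectory := {G | ∀ i ≤ t, leafCount G i = x i}

theorem indicator_observed_congr {t : ℕ} {x : ℕ → ℕ} {G G' : Trajectory}
    (h : ∀ i ≤ t, G i = G' i) :
    (observed t x).indicator (1 : Trajectory → ENNReal) G = (observed t x).indicator 1 G' := by
  have : G ∈ observed t x ↔ G' ∈ observed t x := by
    refine forall₂_congr fun i hi => ?_
    simp only [leafCount, h i hi]
  by_cases hG : G ∈ observed t x
  · rw [Set.indicator_of_mem hG, Set.indicator_of_mem (this.1 hG)]; rfl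
  · rw [Set.indicator_of_notMem hG, Set.indicator_of_notMem (this.not.1 hG)]

/-- The event is decided by time `t₀`, and each later step acts affinely on the leaf count, so the
recursion of the mean survives restriction to the event. Keeping the probability of the event as a
factor avoids dividing by it. -/
theorem expect_indicator_observed (ha : ∀ t, -1 < a t) {t₀ t : ℕ} (ht : t₀ ≤ t) (x : ℕ → ℕ) :
    (expect (trajectoryLaw y a t) fun G =>
        (observed t₀ x).indicator 1 G * ENNReal.ofReal (leafCount G t)) =
      (trajectoryLaw y a t).toMeasure (observed t₀ x) *
        ENNReal.ofReal (meanFrom y t₀ (x t₀) a t) := by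
  induction t, ht using Nat.le_induction with
  | base =>
    rw [meanFrom_of_le y _ _ le_rfl, ← expect_indicator_one _ (measurableSet_trajectory _), mul_comm,
      ← expect_const_mul]
    refine expect_congr fun G _ => ?_
    by_cases hG : G ∈ observed t₀ x
    · rw [hG t₀ le_rfl, mul_comm]
    · rw [Set.indicator_of_notMem hG]; simp
  | succ t ht ih =>
    have h1 : ∀ G ∈ (trajectoryLaw y a t).support,
        (expect (Network.step (y (t + 1)) (a (t + 1)) (G t)) fun g =>
          (observed t₀ x).indicator 1 (G.extend t g) *
            ENNReal.ofReal (leafCount (G.extend t g) (t + 1))) =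
        ENNReal.ofReal (keepProb y (a (t + 1)) t) *
            ((observed t₀ x).indicator 1 G * ENNReal.ofReal (leafCount G t)) +
          ENNReal.ofReal (if y (t + 1) then 1 else 0) * (observed t₀ x).indicator 1 G := by
      intro G hG
      have h2 : ∀ g, (observed t₀ x).indicator (1 : Trajectory → ENNReal) (G.extend t g) =
          (observed t₀ x).indicator 1 G := fun g =>
        indicator_observed_congr fun i hi => Trajectory.extend_of_le _ _ (hi.trans ht)
      simp only [h2, leafCount, Trajectory.extend_succ]
      rw [expect_const_mul,
        (wellFormed_of_mem_support ha le_rfl hG).expect_step_leaves (ha _), stepMean,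
        ENNReal.ofReal_add (mul_nonneg (keepProb_nonneg y (ha _) t) (Nat.cast_nonneg _))
          (by split_ifs <;> norm_num), ENNReal.ofReal_mul (keepProb_nonneg y (ha _) t)]
      ring
    have h3 : (trajectoryLaw y a (t + 1)).toMeasure (observed t₀ x) =
        (trajectoryLaw y a t).toMeasure (observed t₀ x) := by
      simp only [← expect_indicator_one _ (measurableSet_trajectory _)]
      exact expect_trajectoryLaw_of_le y a (Nat.le_succ t) fun G G' h =>
        indicator_observed_congr fun i hi => h i (hi.trans ht)
    rw [expect_trajectoryLaw_succ, expect_congr h1, expect_add, expect_const_mul, expect_const_mul,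
      ih, expect_indicator_one _ (measurableSet_trajectory _), h3, meanFrom_succ y _ _ ht, stepMean,
      ENNReal.ofReal_add (mul_nonneg (keepProb_nonneg y (ha _) t)
        (meanFrom_nonneg y t₀ ha (Nat.cast_nonneg _) t)) (by split_ifs <;> norm_num),
      ENNReal.ofReal_mul (keepProb_nonneg y (ha _) t)]
    ring

/-- The conditional mean of the number of leaves, given a possible history. -/
theorem condMean_eq_meanFrom (ha : ∀ t, -1 < a t) {T t₀ t₁ : ℕ} (h₀₁ : t₀ ≤ t₁) (h₀ : t₀ ≤ T)
    {G : Trajectory} (hG : G ∈ (trajectoryLaw y a T).support) {α : ℝ} (hα : -1 < α) :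
    condMean y t₀ t₁ (leafCount G) α =
      meanFrom y t₀ (leafCount G t₀) (fun _ => α) t₁ := by
  set A := observed t₀ (leafCount G) with hA
  set μ := (trajectoryLaw y (fun _ => α) t₁).toMeasure with hμ
  -- The event concerns times up to `t₀` only, so its probability is the same at horizons `t₁`, `t₀`
  -- and `T`; at `T` the trajectory `G` itself witnesses positivity.
  have hμA : μ A ≠ 0 := by
    have h1 : ∀ t, t₀ ≤ t → (trajectoryLaw y (fun _ => α) t).toMeasure A =
        (trajectoryLaw y (fun _ => α) t₀).toMeasure A := by
      intro t ht
      simp only [← expect_indicator_one _ (measurableSet_trajectory _)]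
      exact expect_trajectoryLaw_of_le y _ ht fun G G' h => indicator_observed_congr h
    rw [hμ, h1 t₁ h₀₁, ← h1 T h₀, Ne,
      PMF.toMeasure_apply_eq_zero_iff _ (measurableSet_trajectory _)]
    exact Set.not_disjoint_iff.2
      ⟨G, support_trajectoryLaw_subset ha (fun _ => hα) T hG, fun i _ => rfl⟩
  have hint : ∫ G' in A, (leafCount G' t₁ : ℝ) ∂μ =
      (μ A).toReal * meanFrom y t₀ (leafCount G t₀) (fun _ => α) t₁ := by
    have hm : Measurable fun G' : Trajectory => (leafCount G' t₁ : ℝ) := fun s _ => trivial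
    rw [integral_eq_lintegral_of_nonneg_ae (ae_of_all _ fun _ => Nat.cast_nonneg _)
      hm.aestronglyMeasurable, ← lintegral_indicator (measurableSet_trajectory A),
      lintegral_toMeasure_eq_expect _ measurableSet_trajectory]
    have : (A.indicator fun G' : Trajectory => ENNReal.ofReal (leafCount G' t₁ : ℝ)) = fun G' =>
        A.indicator 1 G' * ENNReal.ofReal (leafCount G' t₁) := by
      funext G'
      by_cases h : G' ∈ A <;> simp [h]
    rw [this, expect_indicator_observed (fun _ => hα) h₀₁, ENNReal.toReal_mul,
      ENNReal.toReal_ofReal (meanFrom_nonneg y t₀ (fun _ => hα) (Nat.cast_nonneg _) t₁)]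
  change ∫ G', (leafCount G' t₁ : ℝ) ∂(ProbabilityTheory.cond μ A) = _
  have hne : (μ A).toReal ≠ 0 := ENNReal.toReal_ne_zero.2 ⟨hμA, measure_ne_top μ A⟩
  rw [ProbabilityTheory.cond, integral_smul_measure, hint, ENNReal.toReal_inv, smul_eq_mul,
    ← mul_assoc, inv_mul_cancel₀ hne, one_mul]

/-! ### Concentration of the number of leaves -/

/-- One step contributes at most 4, and the earlier deviation is multiplied by a slope in `[0, 1]`,
so the bounds add up. -/
theorem expect_sq_leafCount_sub_le (ha : ∀ t, -1 < a t) (t : ℕ) :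
    (expect (trajectoryLaw y a t) fun G =>
      ENNReal.ofReal (((leafCount G t : ℝ) - meanLeaves y a t) ^ 2)) ≤ ENNReal.ofReal (4 * t) := by
  induction t with
  | zero =>
    rw [expect_congr (g := fun _ => 0), expect_const]
    · simp
    · intro G hG
      rw [leafCount_zero_of_mem_support hG, meanLeaves_zero]
      simp
  | succ t ih =>
    rw [expect_trajectoryLaw_succ]
    have h1 : ∀ G ∈ (trajectoryLaw y a t).support,
        (expect (Network.step (y (t + 1)) (a (t + 1)) (G t)) fun g => ENNReal.ofReal
          (((leafCount (G.extend t g) (t + 1) : ℝ) - meanLeaves y a (t + 1)) ^ 2)) ≤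
        ENNReal.ofReal 4 +
          ENNReal.ofReal (((leafCount G t : ℝ) - meanLeaves y a t) ^ 2) := by
      intro G hG
      simp only [leafCount, Trajectory.extend_succ]
      refine ((wellFormed_of_mem_support ha le_rfl hG).expect_step_sq_le (ha _) _).trans ?_
      rw [← ENNReal.ofReal_add (by norm_num) (sq_nonneg _)]
      refine ENNReal.ofReal_le_ofReal ?_
      have h2 := keepProb_nonneg y (ha (t + 1)) t
      have h3 := keepProb_le_one y (ha (t + 1)) t
      rw [meanLeaves_succ, stepMean, stepMean, add_sub_add_right_eq_sub, ← mul_sub, mul_pow]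
      have := mul_le_of_le_one_left (sq_nonneg (((G t).leaves : ℝ) - meanLeaves y a t))
        (pow_le_one₀ (n := 2) h2 h3)
      linarith
    refine (expect_mono h1).trans ?_
    rw [expect_add, expect_const]
    refine (add_le_add_right ih _).trans ?_
    rw [← ENNReal.ofReal_add (by norm_num) (by positivity)]
    refine ENNReal.ofReal_le_ofReal ?_
    push_cast
    linarith

theorem toMeasure_lt_abs_leafCount_sub_le (ha : ∀ t, -1 < a t) {t T : ℕ} (ht : t ≤ T) {δ : ℝ}
    (hδ : 0 < δ) :
    (trajectoryLaw y a T).toMeasure {G | δ < |(leafCount G t : ℝ) - meanLeaves y a t|} ≤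
      ENNReal.ofReal (4 * T / δ ^ 2) := by
  have h1 : (expect (trajectoryLaw y a T) fun G =>
      ENNReal.ofReal (((leafCount G t : ℝ) - meanLeaves y a t) ^ 2)) ≤ ENNReal.ofReal (4 * T) := by
    rw [expect_trajectoryLaw_of_le y a ht]
    · refine (expect_sq_leafCount_sub_le ha t).trans (ENNReal.ofReal_le_ofReal ?_)
      gcongr
    · intro G G' h
      simp only [leafCount, h t le_rfl]
  have h2 := (mul_toMeasure_le_expect (trajectoryLaw y a T) (measurableSet_trajectory
    {G | δ < |(leafCount G t : ℝ) - meanLeaves y a t|}) (ENNReal.ofReal (δ ^ 2)) (fun G =>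
      ENNReal.ofReal (((leafCount G t : ℝ) - meanLeaves y a t) ^ 2)) (by
        intro G hG
        refine ENNReal.ofReal_le_ofReal ?_
        rw [← sq_abs (_ - _)]
        exact pow_le_pow_left₀ hδ.le (le_of_lt hG) 2)).trans h1
  rw [ENNReal.ofReal_div_of_pos (by positivity), ENNReal.le_div_iff_mul_le]
  · rwa [mul_comm]
  · left; simpa using hδ.ne'
  · left; simp

/-- The leaf counts are uniformly close to their means with high probability. -/
theorem exists_toMeasure_exists_lt_abs_leafCount_sub_le {ε : ℝ} (hε : 0 < ε) :
    ∃ C : ℝ, ∀ (T : ℕ) (y : ℕ → Bool) (a : ℕ → ℝ), 0 < T → (∀ t, -1 < a t) →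
      (trajectoryLaw y a T).toMeasure
        {G | ∃ t ≤ T, ε * T < |(leafCount G t : ℝ) - meanLeaves y a t|} ≤
          ENNReal.ofReal (C / T) := by
  refine ⟨(⌈8 / ε⌉₊ + 1 : ℕ) * (16 / ε ^ 2), fun T y a hT ha => ?_⟩
  have hT' : (0 : ℝ) < T := by exact_mod_cast hT
  -- Grid spacing. From the preceding grid point, the leaf count and its mean each move by at most
  -- `2 * (ε * T / 8)`, so a deviation above `ε * T` leaves at least `ε * T / 2` at that grid point.
  -- Boundedly many grid points lie in `[0, T]`.
  set h := ⌊ε * T / 8⌋₊ + 1 with hh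
  have hh1 : ε * T / 8 < h := by rw [hh]; push_cast; exact Nat.lt_floor_add_one _
  have hh2 : (h : ℝ) ≤ ε * T / 8 + 1 := by
    rw [hh]; push_cast; gcongr; exact Nat.floor_le (by positivity)
  set B : ℕ → Set Trajectory := fun j =>
    {G | j * h ≤ T ∧ ε * T / 2 < |(leafCount G (j * h) : ℝ) - meanLeaves y a (j * h)|} with hB
  -- The bound on the increments of the leaf count is available only for possible trajectories,
  -- hence the intersection with the support.
  have hsub : {G : Trajectory | ∃ t ≤ T, ε * T < |(leafCount G t : ℝ) - meanLeaves y a t|} ∩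
      (trajectoryLaw y a T).support ⊆ ⋃ j ∈ Finset.range (⌈8 / ε⌉₊ + 1), B j := by
    rintro G ⟨⟨t, ht, hGt⟩, hG⟩
    have hdm := Nat.div_add_mod' t h
    have hmod := Nat.mod_lt t (show 0 < h by omega)
    have hle : t / h * h ≤ t := by omega
    have hj : t / h < ⌈8 / ε⌉₊ + 1 := by
      refine Nat.lt_succ_of_le (Nat.le_of_lt_succ ?_)
      have h3 : ((t / h : ℕ) : ℝ) * h ≤ T := by exact_mod_cast hle.trans ht
      have h4 : ((t / h : ℕ) : ℝ) ≤ 8 / ε := by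
        rw [le_div_iff₀ hε]
        by_contra hcon
        push Not at hcon
        have h5 : ((t / h : ℕ) : ℝ) * (ε * T / 8) ≤ T :=
          (mul_le_mul_of_nonneg_left hh1.le (Nat.cast_nonneg _)).trans h3
        nlinarith
      have h5 : ((t / h : ℕ) : ℝ) ≤ ⌈8 / ε⌉₊ := h4.trans (Nat.le_ceil _)
      have : t / h ≤ ⌈8 / ε⌉₊ := by exact_mod_cast h5
      omega
    simp only [Set.mem_iUnion, Finset.mem_range]
    refine ⟨t / h, hj, hle.trans ht, ?_⟩
    have h6 := abs_sub_le_two_mul_of_succ (T := T) (f := fun t => (leafCount G t : ℝ))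
      (fun t ht => abs_leafCount_succ_sub_le ha ht hG) hle ht
    have h7 := abs_sub_le_two_mul_of_succ (T := T) (f := meanLeaves y a)
      (fun t _ => abs_meanLeaves_succ_sub_le y ha t) hle ht
    have h8 : (t : ℝ) - (t / h * h : ℕ) ≤ ε * T / 8 := by
      have : t - t / h * h + 1 ≤ h := by omega
      have : ((t - t / h * h : ℕ) : ℝ) + 1 ≤ h := by exact_mod_cast this
      rw [Nat.cast_sub hle] at this
      linarith
    set s := t / h * h
    have h9 : (leafCount G t : ℝ) - meanLeaves y a t = (leafCount G t - leafCount G s)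
      + (leafCount G s - meanLeaves y a s) - (meanLeaves y a t - meanLeaves y a s) := by ring
    rw [h9] at hGt
    have h10 := abs_sub ((leafCount G t : ℝ) - leafCount G s
      + (leafCount G s - meanLeaves y a s)) (meanLeaves y a t - meanLeaves y a s)
    have h11 := abs_add_le ((leafCount G t : ℝ) - leafCount G s)
      (leafCount G s - meanLeaves y a s)
    linarith
  have hBj : ∀ j, (trajectoryLaw y a T).toMeasure (B j) ≤ ENNReal.ofReal (16 / ε ^ 2 / T) := by
    intro j
    by_cases hj : j * h ≤ T
    · refine (measure_mono (fun G hG => hG.2)).trans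
        ((toMeasure_lt_abs_leafCount_sub_le ha hj (by positivity)).trans
          (ENNReal.ofReal_le_ofReal (le_of_eq ?_)))
      field_simp
      ring
    · have : B j = ∅ := by
        ext G; simp only [hB, Set.mem_ofPred_eq, Set.mem_empty_iff_false, iff_false]
        exact fun hc => hj hc.1
      rw [this]; simp
  calc _ ≤ (trajectoryLaw y a T).toMeasure (⋃ j ∈ Finset.range (⌈8 / ε⌉₊ + 1), B j) :=
        PMF.toMeasure_mono _ (measurableSet_trajectory _) hsub
    _ ≤ ∑ j ∈ Finset.range (⌈8 / ε⌉₊ + 1), (trajectoryLaw y a T).toMeasure (B j) :=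
        measure_biUnion_finset_le _ _
    _ ≤ ∑ j ∈ Finset.range (⌈8 / ε⌉₊ + 1), ENNReal.ofReal (16 / ε ^ 2 / T) :=
        Finset.sum_le_sum fun j _ => hBj j
    _ = _ := by
        rw [Finset.sum_const, Finset.card_range, nsmul_eq_mul, ← ENNReal.ofReal_natCast,
          ← ENNReal.ofReal_mul (Nat.cast_nonneg _), mul_div_assoc]

end Trajectories

/-! ### Dependence of the mean on the parameters -/

section Parameters

variable {y : ℕ → Bool}

/-- The factor `2 * t + 1 - vertexCount y t` is the total degree in excess of one per vertex. It is
nonnegative, which gives monotonicity in the parameter, and at least `t`, which later makes the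
monotonicity quantitative. -/
theorem hitProb_sub (y : ℕ → Bool) {a b : ℝ} (ha : -1 < a) (hb : -1 < b) (t : ℕ) :
    hitProb y b t - hitProb y a t =
      (b - a) * (2 * t + 1 - vertexCount y t) / (totalWeight y b t * totalWeight y a t) := by
  have h1 := (totalWeight_pos y ha t).ne'
  have h2 := (totalWeight_pos y hb t).ne'
  unfold hitProb
  rw [div_sub_div _ _ h2 h1]
  congr 1
  unfold totalWeight
  ring

theorem two_mul_add_one_sub_vertexCount_nonneg (y : ℕ → Bool) (t : ℕ) :
    (0 : ℝ) ≤ 2 * t + 1 - vertexCount y t := by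
  have := vertexCount_le_real y t
  have : (0 : ℝ) ≤ t := t.cast_nonneg
  linarith

theorem hitProb_mono (y : ℕ → Bool) {a b : ℝ} (ha : -1 < a) (hab : a ≤ b) (t : ℕ) :
    hitProb y a t ≤ hitProb y b t := by
  have hb : -1 < b := ha.trans_le hab
  rw [← sub_nonneg, hitProb_sub y ha hb]
  exact div_nonneg (mul_nonneg (by linarith) (two_mul_add_one_sub_vertexCount_nonneg y t))
    (mul_pos (totalWeight_pos y hb t) (totalWeight_pos y ha t)).le

theorem abs_hitProb_sub_mul_vertexCount_le (y : ℕ → Bool) {a b : ℝ} (ha : -1 < a) (hb : -1 < b)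
    (t : ℕ) : |hitProb y a t - hitProb y b t| * vertexCount y t ≤ 2 * |a - b| := by
  have h1 := totalWeight_pos y ha t
  have h2 := totalWeight_pos y hb t
  have hN := two_mul_add_one_sub_vertexCount_nonneg y t
  have hv := one_le_vertexCount_real y t
  have hle := vertexCount_le_real y t
  rw [hitProb_sub y hb ha, abs_div, abs_mul, abs_of_nonneg hN, abs_of_pos (mul_pos h1 h2),
    div_mul_eq_mul_div, div_le_iff₀ (mul_pos h1 h2)]
  set N : ℝ := 2 * t + 1 - vertexCount y t with hNdef
  have hNa : N ≤ totalWeight y a t := by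
    rw [totalWeight_eq]; nlinarith
  have hNb : N ≤ totalWeight y b t := by
    rw [totalWeight_eq]; nlinarith
  -- At `t = 0` the bound `vertexCount y t ≤ 2 * N` fails, but there `N = 0`; the factor `N` makes
  -- the inequality true in all cases.
  have hvN : N * vertexCount y t ≤ N * (2 * N) := by
    rcases Nat.eq_zero_or_pos t with rfl | ht
    · have : N = 0 := by rw [hNdef, vertexCount_zero]; norm_num
      simp [this]
    · have : (1 : ℝ) ≤ t := by exact_mod_cast ht
      exact mul_le_mul_of_nonneg_left (by linarith) hN
  calc |a - b| * N * vertexCount y t = |a - b| * (N * vertexCount y t) := by ring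
    _ ≤ |a - b| * (N * (2 * N)) := by gcongr
    _ = 2 * |a - b| * (N * N) := by ring
    _ ≤ 2 * |a - b| * (totalWeight y a t * totalWeight y b t) := by gcongr

theorem keepProb_anti (y : ℕ → Bool) {a b : ℝ} (ha : -1 < a) (hab : a ≤ b) (t : ℕ) :
    keepProb y b t ≤ keepProb y a t := by
  have h1 := hitProb_mono y ha hab t
  have h2 := hitProb_le_one y (ha.trans_le hab) t
  unfold keepProb
  split_ifs
  · linarith
  · exact pow_le_pow_left₀ (by linarith) (by linarith) 2

/-- In an edge-step the difference of the squares carries the factor `2 - hitProb y a t - hitProb y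
b t`, which is at least 1 when both probabilities are at most `1 / 2`. -/
theorem hitProb_sub_le_keepProb_sub (y : ℕ → Bool) {a b : ℝ} (ha : -1 < a) (hab : a ≤ b) {t : ℕ}
    (hb : hitProb y b t ≤ 1 / 2) :
    hitProb y b t - hitProb y a t ≤ keepProb y a t - keepProb y b t := by
  have h1 := hitProb_mono y ha hab t
  unfold keepProb
  split_ifs
  · linarith
  · nlinarith

theorem abs_keepProb_sub_le (y : ℕ → Bool) {a b : ℝ} (ha : -1 < a) (hb : -1 < b) (t : ℕ) :
    |keepProb y a t - keepProb y b t| ≤ 2 * |hitProb y a t - hitProb y b t| := by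
  have h1 := hitProb_le_one y ha t
  have h2 := hitProb_le_one y hb t
  have h3 := hitProb_nonneg y ha t
  have h4 := hitProb_nonneg y hb t
  unfold keepProb
  split_ifs
  · rw [sub_sub_sub_cancel_left, abs_sub_comm]
    linarith [abs_nonneg (hitProb y a t - hitProb y b t)]
  · have : (1 - hitProb y a t) ^ 2 - (1 - hitProb y b t) ^ 2 =
        (2 - hitProb y a t - hitProb y b t) * (hitProb y b t - hitProb y a t) := by ring
    rw [this, abs_mul, abs_sub_comm (hitProb y b t)]
    gcongr
    rw [abs_le]
    constructor <;> linarith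

variable {a b : ℕ → ℝ}

/-- A larger parameter makes each leaf less likely to survive, and the recursion is increasing in
the nonnegative leaf count. -/
theorem meanFrom_anti (ha : ∀ t, -1 < a t) {t₀ t : ℕ} {w : ℝ} (hw : 0 ≤ w)
    (hab : ∀ s ≤ t, a s ≤ b s) : meanFrom y t₀ w b t ≤ meanFrom y t₀ w a t := by
  induction t with
  | zero => exact le_rfl
  | succ t ih =>
    have ih := ih fun s hs => hab s (hs.trans t.le_succ)
    rw [meanFrom, meanFrom]
    split_ifs
    · exact le_rfl
    · have h1 := keepProb_anti y (ha (t + 1)) (hab (t + 1) le_rfl) t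
      have h2 := keepProb_nonneg y ((ha (t + 1)).trans_le (hab (t + 1) le_rfl)) t
      have h3 := meanFrom_nonneg y t₀ ha hw t
      have h4 : keepProb y (b (t + 1)) t * meanFrom y t₀ w b t ≤
          keepProb y (a (t + 1)) t * meanFrom y t₀ w a t :=
        (mul_le_mul_of_nonneg_left ih h2).trans (mul_le_mul_of_nonneg_right h1 h3)
      unfold stepMean
      gcongr

theorem continuousOn_hitProb (y : ℕ → Bool) (t : ℕ) :
    ContinuousOn (fun α => hitProb y α t) (Set.Ioi (-1)) := by
  unfold hitProb
  refine ContinuousOn.div (by fun_prop) ?_ fun α hα => (totalWeight_pos y hα t).ne'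
  unfold totalWeight
  fun_prop

theorem continuousOn_meanFrom (y : ℕ → Bool) (t₀ : ℕ) (w : ℝ) (t : ℕ) :
    ContinuousOn (fun α => meanFrom y t₀ w (fun _ => α) t) (Set.Ioi (-1)) := by
  induction t with
  | zero => exact continuousOn_const
  | succ t ih =>
    have h := continuousOn_hitProb y t
    simp only [meanFrom]
    split_ifs
    · exact continuousOn_const
    · unfold stepMean keepProb
      refine ContinuousOn.add (ContinuousOn.mul ?_ ih) continuousOn_const
      split_ifs
      · exact continuousOn_const.sub h
      · exact (continuousOn_const.sub h).pow 2

theorem meanLeaves_congr {t : ℕ} (h : ∀ s ≤ t, a s = b s) :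
    meanLeaves y a t = meanLeaves y b t := by
  induction t with
  | zero => rfl
  | succ t ih =>
    rw [meanLeaves_succ, meanLeaves_succ, ih fun s hs => h s (hs.trans t.le_succ), h _ le_rfl]

/-- The parameters `a` up to time `t₀`, and the constant parameter `α` afterwards. -/
noncomputable def splice (a : ℕ → ℝ) (t₀ : ℕ) (α : ℝ) (s : ℕ) : ℝ := if s ≤ t₀ then a s else α

theorem splice_gt (ha : ∀ t, -1 < a t) (t₀ : ℕ) {α : ℝ} (hα : -1 < α) (s : ℕ) :
    -1 < splice a t₀ α s := by
  unfold splice; split_ifs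
  · exact ha s
  · exact hα

/-- Both sequences follow the same recursion after `t₀`, and slopes in `[0, 1]` do not enlarge the
initial difference. A forecast from an observed count can thus be replaced by an unconditional mean
with spliced parameters. -/
theorem abs_meanFrom_sub_meanLeaves_splice_le {t₀ t : ℕ} (ht : t₀ ≤ t) (w : ℝ) {α : ℝ}
    (hα : -1 < α) :
    |meanFrom y t₀ w (fun _ => α) t - meanLeaves y (splice a t₀ α) t| ≤
      |w - meanLeaves y a t₀| := by
  induction t, ht using Nat.le_induction with
  | base =>
    rw [meanFrom_of_le y _ _ le_rfl,
      meanLeaves_congr (b := a) fun s hs => by simp [splice, hs]]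
  | succ t ht ih =>
    have h1 : splice a t₀ α (t + 1) = α := by rw [splice, if_neg (by omega)]
    rw [meanFrom_succ y _ _ ht, meanLeaves_succ, h1, stepMean, stepMean, add_sub_add_right_eq_sub,
      ← mul_sub, abs_mul, abs_of_nonneg (keepProb_nonneg y hα t)]
    exact (mul_le_of_le_one_left (abs_nonneg _) (keepProb_le_one y hα t)).trans ih

/-- Per step, the survival probability changes by at most `4 * η / vertexCount y t`, and this acts
on a mean of at most `vertexCount y t` leaves; earlier differences are not amplified. -/
theorem abs_meanLeaves_sub_le (ha : ∀ t, -1 < a t) (hb : ∀ t, -1 < b t) {t : ℕ} {η : ℝ}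
    (hab : ∀ s ≤ t, |a s - b s| ≤ η) :
    |meanLeaves y a t - meanLeaves y b t| ≤ 4 * t * η := by
  induction t with
  | zero => simp [meanLeaves_zero]
  | succ t ih =>
    have ih := ih fun s hs => hab s (hs.trans t.le_succ)
    set s := t + 1
    have h1 : meanLeaves y a s - meanLeaves y b s =
        keepProb y (a s) t * (meanLeaves y a t - meanLeaves y b t) +
          (keepProb y (a s) t - keepProb y (b s) t) * meanLeaves y b t := by
      rw [meanLeaves_succ, meanLeaves_succ, stepMean, stepMean]; ring
    have h2 : |keepProb y (a s) t * (meanLeaves y a t - meanLeaves y b t)| ≤ 4 * t * η := by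
      rw [abs_mul, abs_of_nonneg (keepProb_nonneg y (ha s) t)]
      exact (mul_le_of_le_one_left (abs_nonneg _) (keepProb_le_one y (ha s) t)).trans ih
    have h3 : |(keepProb y (a s) t - keepProb y (b s) t) * meanLeaves y b t| ≤ 4 * η := by
      rw [abs_mul, abs_of_nonneg (meanLeaves_nonneg y hb t)]
      calc _ ≤ 2 * |hitProb y (a s) t - hitProb y (b s) t| * vertexCount y t := by
            gcongr
            · exact meanLeaves_nonneg y hb t
            · exact abs_keepProb_sub_le y (ha s) (hb s) t
            · exact meanLeaves_le y hb t
        _ ≤ 4 * η := by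
            have := abs_hitProb_sub_mul_vertexCount_le y (ha s) (hb s) t
            have := hab s le_rfl
            linarith
    rw [h1]
    refine (abs_add_le _ _).trans ?_
    have h4 : (s : ℝ) = t + 1 := Nat.cast_succ t
    rw [h4]
    linarith

end Parameters

/-! ### Separation of the means -/

/-- Each contribution `h t` is discounted at most `n - u` times by `1 - κ`. In the applications `κ`
is of order `1 / T`, so the total discount is bounded below by a constant. -/
theorem pow_mul_sum_le_of_recursion {z h : ℕ → ℝ} {κ : ℝ} (hκ0 : 0 ≤ κ) (hκ1 : κ ≤ 1) {u n : ℕ}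
    (hun : u ≤ n) (hu : 0 ≤ z u) (hh : ∀ t, 0 ≤ h t)
    (hz : ∀ t, u ≤ t → t < n → (1 - κ) * z t + h t ≤ z (t + 1)) :
    (1 - κ) ^ (n - u) * ∑ t ∈ Finset.Ico u n, h t ≤ z n := by
  induction n, hun using Nat.le_induction with
  | base => simpa using hu
  | succ n hn ih =>
    have ih := ih fun t h1 h2 => hz t h1 (h2.trans n.lt_succ_self)
    have h1 := hz n hn n.lt_succ_self
    have h2 : (1 - κ) ^ (n + 1 - u) ≤ 1 := pow_le_one₀ (by linarith) (by linarith)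
    rw [Finset.sum_Ico_succ_top hn, mul_add]
    have h3 : (1 - κ) ^ (n + 1 - u) * ∑ t ∈ Finset.Ico u n, h t ≤ (1 - κ) * z n := by
      rw [Nat.succ_sub hn, pow_succ', mul_assoc]
      exact mul_le_mul_of_nonneg_left ih (by linarith)
    have h4 := mul_le_of_le_one_left (hh n) h2
    linarith

/-- For `κ ≤ 1 / 2` one has `1 / (1 - κ) ≤ 1 + 2 * κ ≤ exp (2 * κ)`. -/
theorem exp_le_one_sub_pow {κ C : ℝ} (hκ0 : 0 ≤ κ) (hκ : κ ≤ 1 / 2) {n : ℕ} (hC : 2 * κ * n ≤ C) :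
    Real.exp (-C) ≤ (1 - κ) ^ n := by
  have h1 : Real.exp (-(2 * κ)) ≤ 1 - κ := by
    rw [Real.exp_neg, inv_le_comm₀ (Real.exp_pos _) (by linarith)]
    refine le_trans ?_ (Real.add_one_le_exp _)
    rw [inv_le_iff_one_le_mul₀ (by linarith)]
    nlinarith
  calc Real.exp (-C) ≤ Real.exp (n * -(2 * κ)) := Real.exp_le_exp.2 (by linarith)
    _ = Real.exp (-(2 * κ)) ^ n := Real.exp_nat_mul _ _
    _ ≤ (1 - κ) ^ n := by gcongr

theorem sum_Ico_vertexSteps (y : ℕ → Bool) {u n : ℕ} (h : u ≤ n) :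
    (∑ t ∈ Finset.Ico u n, if y (t + 1) then (1 : ℝ) else 0) =
      vertexCount y n - vertexCount y u := by
  induction n, h using Nat.le_induction with
  | base => simp
  | succ n hn ih =>
    rw [Finset.sum_Ico_succ_top hn, ih, vertexCount_succ]
    split_ifs <;> push_cast <;> ring

theorem hitProb_le_of_le_vertexCount (y : ℕ → Bool) {a : ℝ} (ha : -1 < a) {t : ℕ} {m : ℝ}
    (hm : 0 < m) (h : m ≤ vertexCount y t) : hitProb y a t ≤ 1 / m := by
  rw [le_div_iff₀ hm]
  exact (mul_le_mul_of_nonneg_left h (hitProb_nonneg y ha t)).trans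
    (hitProb_mul_vertexCount_le y ha t)

/-- The density of vertices is at least `p` up to time `T`. -/
def IsDense (p : ℝ) (T : ℕ) (y : ℕ → Bool) : Prop :=
  ∀ t : ℕ, 0 < t → t ≤ T → p ≤ (vertexCount y t : ℝ) / t

theorem IsDense.mul_le {p : ℝ} {T : ℕ} {y : ℕ → Bool} (h : IsDense p T y) {t : ℕ} (ht : t ≤ T) :
    p * t ≤ vertexCount y t := by
  rcases Nat.eq_zero_or_pos t with rfl | h0
  · simp
  · exact (le_div_iff₀ (by exact_mod_cast h0)).1 (h t h0 ht)

/-- The mean number of leaves grows linearly. -/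
theorem exists_mul_le_meanLeaves {p c : ℝ} (hp : 0 < p) (hc : 0 < c) :
    ∃ β > 0, ∃ T₀ : ℕ, ∀ T ≥ T₀, ∀ y, IsDense p T y → ∀ a : ℕ → ℝ, (∀ t, -1 < a t) →
      ∀ t ≤ T, c * T ≤ t → β * T ≤ meanLeaves y a t := by
  -- The recursion starts near time `d * T`: late enough for hitting probabilities `O(1 / T)`, early
  -- enough that the vertices already present are few compared with the at least `p * c * T`
  -- vertices at time `t`.
  set d := min (p * c / 4) (c / 2) with hd
  have hd0 : 0 < d := by positivity
  have hdp : d ≤ p * c / 4 := min_le_left _ _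
  have hdc : d ≤ c / 2 := min_le_right _ _
  refine ⟨Real.exp (-(4 / (p * d))) * (p * c / 4), by positivity,
    ⌈max (4 / (p * d)) (max (2 / d) (8 / (p * c)))⌉₊, fun T hT y hy a ha t ht hct => ?_⟩
  have hT' := (Nat.le_ceil _).trans (show ((_ : ℕ) : ℝ) ≤ (T : ℝ) from Nat.cast_le.2 hT)
  have hT1 : 4 / (p * d) ≤ T := (le_max_left _ _).trans hT'
  have hT2 : 2 / d ≤ T := (le_max_left _ _).trans ((le_max_right _ _).trans hT')
  have hT3 : 8 / (p * c) ≤ T := (le_max_right _ _).trans ((le_max_right _ _).trans hT')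
  rw [div_le_iff₀ (by positivity)] at hT1 hT2 hT3
  have hT0 : (0 : ℝ) < T := by
    by_contra h
    have : (T : ℝ) = 0 := le_antisymm (not_lt.1 h) T.cast_nonneg
    rw [this] at hT1; linarith
  -- the leaves born after time `u` are counted
  set u := ⌈d * T⌉₊ with hu
  have hu1 : d * T ≤ u := Nat.le_ceil _
  have hu2 : (u : ℝ) < d * T + 1 := Nat.ceil_lt_add_one (by positivity)
  have hut : u ≤ t := by
    have : (u : ℝ) ≤ t := by nlinarith
    exact_mod_cast this
  set κ := 2 / (p * d * T) with hκ
  have hκ0 : 0 ≤ κ := by positivity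
  have hκ1 : κ ≤ 1 / 2 := by
    rw [hκ, div_le_iff₀ (by positivity)]; linarith
  have hrec := pow_mul_sum_le_of_recursion (z := meanLeaves y a)
    (h := fun t => if y (t + 1) then 1 else 0) hκ0 (by linarith) hut
    (meanLeaves_nonneg y ha u) (fun t => by split_ifs <;> norm_num) (by
      intro s hs1 hs2
      rw [meanLeaves_succ, stepMean]
      have h1 : hitProb y (a (s + 1)) s ≤ 1 / (p * d * T) := by
        refine hitProb_le_of_le_vertexCount y (ha _) (by positivity) ?_
        refine le_trans ?_ (hy.mul_le (hs2.le.trans ht))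
        rw [mul_assoc]
        have : (u : ℝ) ≤ s := by exact_mod_cast hs1
        gcongr
        linarith
      have h2 := one_sub_two_mul_hitProb_le y (ha (s + 1)) s
      have h3 : 1 - κ ≤ keepProb y (a (s + 1)) s := by
        have : κ = 2 * (1 / (p * d * T)) := by rw [hκ]; ring
        linarith
      have := meanLeaves_nonneg y ha s
      gcongr)
  refine le_trans ?_ hrec
  rw [sum_Ico_vertexSteps y hut, mul_assoc]
  have hexp : Real.exp (-(4 / (p * d))) ≤ (1 - κ) ^ (t - u) := by
    refine exp_le_one_sub_pow hκ0 hκ1 ?_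
    have h1 : ((t - u : ℕ) : ℝ) ≤ T := by exact_mod_cast (Nat.sub_le _ _).trans ht
    calc 2 * κ * ((t - u : ℕ) : ℝ) ≤ 2 * κ * T := by gcongr
      _ = 4 / (p * d) := by rw [hκ]; field_simp; ring
  have hsum : p * c / 4 * T ≤ vertexCount y t - vertexCount y u := by
    have h1 := hy.mul_le ht
    have h2 := vertexCount_le_real y u
    have h3 : p * (c * T) ≤ p * t := by gcongr
    nlinarith
  have hpow : 0 ≤ (1 - κ) ^ (t - u) := pow_nonneg (by linarith) _
  gcongr

/-- Increasing the parameters by a fixed amount during a positive fraction of the time decreases the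
mean number of leaves by a positive fraction. -/
theorem exists_mul_le_meanLeaves_sub {p c e g B : ℝ} (hp : 0 < p) (hc : 0 < c) (he : 0 < e)
    (hg : 0 < g) (hB : 0 ≤ B) :
    ∃ δ > 0, ∃ T₀ : ℕ, ∀ T ≥ T₀, ∀ y, IsDense p T y → ∀ a b : ℕ → ℝ, (∀ t, -1 < a t) →
      (∀ t, b t ≤ B) → ∀ u w t : ℕ, c * T ≤ u → u + e * T ≤ w → w ≤ t → t ≤ T →
      (∀ s ≤ t, a s ≤ b s) → (∀ s, u < s → s ≤ w → a s + g ≤ b s) →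
      δ * T ≤ meanLeaves y a t - meanLeaves y b t := by
  obtain ⟨β, hβ, T₁, hT₁⟩ := exists_mul_le_meanLeaves hp hc
  -- The difference of the means gains at least `θ` per step between `u` and `w`: the hitting
  -- probabilities differ by at least `g / (4 * (2 + B) ^ 2) / T`, and at least `β * T` leaves are
  -- affected on average.
  set θ := g / (4 * (2 + B) ^ 2) * β with hθ
  have hθ0 : 0 < θ := by positivity
  refine ⟨Real.exp (-(4 / (p * c))) * (e * θ), by positivity,
    max T₁ ⌈max (4 / (p * c)) (1 / c)⌉₊, fun T hT y hy a b ha hbB u w t hu huw hwt htT hab hgap => ?_⟩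
  have hT' := (Nat.le_ceil _).trans
    (show ((_ : ℕ) : ℝ) ≤ (T : ℝ) from Nat.cast_le.2 ((le_max_right _ _).trans hT))
  have hT2 : 4 / (p * c) ≤ T := (le_max_left _ _).trans hT'
  have hT3 : 1 / c ≤ T := (le_max_right _ _).trans hT'
  rw [div_le_iff₀ (by positivity)] at hT2 hT3
  have hT0 : (0 : ℝ) < T := by
    by_contra h
    have : (T : ℝ) = 0 := le_antisymm (not_lt.1 h) T.cast_nonneg
    rw [this] at hT2; linarith
  -- the parameters after time `t` are irrelevant
  set b' : ℕ → ℝ := fun s => if s ≤ t then b s else a s with hb'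
  have hb'b : meanLeaves y b t = meanLeaves y b' t :=
    meanLeaves_congr fun s hs => by simp [hb', hs]
  have hab' : ∀ s, a s ≤ b' s := fun s => by
    simp only [hb']; split_ifs with h
    · exact hab s h
    · exact le_rfl
  have hb1 : ∀ s, -1 < b' s := fun s => (ha s).trans_le (hab' s)
  rw [hb'b]
  have huw' : u ≤ w := by
    have : (u : ℝ) ≤ w := by nlinarith
    exact_mod_cast this
  set κ := 2 / (p * c * T) with hκ
  have hκ0 : 0 ≤ κ := by positivity
  have hκ1 : κ ≤ 1 / 2 := by
    rw [hκ, div_le_iff₀ (by positivity)]; linarith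
  have hrec := pow_mul_sum_le_of_recursion
    (z := fun t => meanLeaves y a t - meanLeaves y b' t)
    (h := fun s => if s < w then θ else 0) hκ0 (by linarith) (huw'.trans hwt)
    (sub_nonneg.2 (meanFrom_anti ha zero_le_one fun s _ => hab' s))
    (fun t => by split_ifs <;> linarith) (by
      intro s hs1 hs2
      have hsT : s ≤ T := hs2.le.trans htT
      have hus : (u : ℝ) ≤ s := by exact_mod_cast hs1
      have hv : p * c * T ≤ vertexCount y s := by
        refine le_trans ?_ (hy.mul_le hsT)
        rw [mul_assoc]
        gcongr
        linarith
      have hpi : ∀ {α : ℝ}, -1 < α → hitProb y α s ≤ 1 / (p * c * T) := fun hα =>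
        hitProb_le_of_le_vertexCount y hα (by positivity) hv
      have hκ2 : κ = 2 * (1 / (p * c * T)) := by rw [hκ]; ring
      have h3 : 1 - κ ≤ keepProb y (a (s + 1)) s := by
        linarith [one_sub_two_mul_hitProb_le y (ha (s + 1)) s, hpi (ha (s + 1))]
      have hz : 0 ≤ meanLeaves y a s - meanLeaves y b' s :=
        sub_nonneg.2 (meanFrom_anti ha zero_le_one fun s _ => hab' s)
      have hstep : meanLeaves y a (s + 1) - meanLeaves y b' (s + 1) =
          keepProb y (a (s + 1)) s * (meanLeaves y a s - meanLeaves y b' s) +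
          (keepProb y (a (s + 1)) s - keepProb y (b' (s + 1)) s) * meanLeaves y b' s := by
        rw [meanLeaves_succ, meanLeaves_succ, stepMean, stepMean]; ring
      rw [hstep]
      have hkeep := keepProb_anti y (ha (s + 1)) (hab' (s + 1)) s
      have hmu := meanLeaves_nonneg y hb1 s
      have hlast : (if s < w then θ else 0) ≤
          (keepProb y (a (s + 1)) s - keepProb y (b' (s + 1)) s) * meanLeaves y b' s := by
        split_ifs with hsw
        · have hgap' : a (s + 1) + g ≤ b' (s + 1) := by
            have := hgap (s + 1) (by omega) (by omega)
            simp only [hb']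
            rwa [if_pos (by omega)]
          have hbB' : b' (s + 1) ≤ B := by
            simp only [hb']
            rw [if_pos (by omega)]
            exact hbB _
          have h4 := hitProb_sub_le_keepProb_sub y (ha (s + 1)) (hab' (s + 1)) (t := s)
            (by linarith [hpi (hb1 (s + 1))])
          have h5 : β * T ≤ meanLeaves y b' s :=
            hT₁ T ((le_max_left _ _).trans hT) y hy b' hb1 s hsT (by linarith)
          have hs1' : (1 : ℝ) ≤ s := by linarith
          have hsT' : (s : ℝ) ≤ T := by exact_mod_cast hsT
          have hvs := vertexCount_le_real y s
          -- Both total weights are at most `(2 + B) * (2 * s)`, while the numerator in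
          -- `hitProb_sub` is at least `g * s`; this is the source of `4 * (2 + B) ^ 2`.
          have hW : ∀ {α : ℝ}, -1 < α → α ≤ B → totalWeight y α s ≤ (2 + B) * (2 * s) := by
            intro α hα hαB
            have h7 := one_le_vertexCount_real y s
            have h6 : α * vertexCount y s ≤ B * (s + 1) := by
              calc _ ≤ B * vertexCount y s := by gcongr
                _ ≤ _ := by gcongr
            have h8 : B * 1 ≤ B * s := by gcongr
            unfold totalWeight
            linarith
          have h6 : g / (4 * (2 + B) ^ 2) / T ≤
              hitProb y (b' (s + 1)) s - hitProb y (a (s + 1)) s := by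
            rw [hitProb_sub y (ha _) (hb1 _)]
            have hWa := hW (ha (s + 1)) (by linarith)
            have hWb := hW (hb1 (s + 1)) hbB'
            have hWa0 := totalWeight_pos y (ha (s + 1)) s
            have hWb0 := totalWeight_pos y (hb1 (s + 1)) s
            calc g / (4 * (2 + B) ^ 2) / T ≤ g / (4 * (2 + B) ^ 2) / s := by gcongr
              _ = g * s / (((2 + B) * (2 * s)) * ((2 + B) * (2 * s))) := by
                field_simp; ring
              _ ≤ _ := by
                gcongr
                · exact mul_nonneg (by linarith) (two_mul_add_one_sub_vertexCount_nonneg y s)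
                · linarith
                · linarith
                · linarith
          calc θ = g / (4 * (2 + B) ^ 2) / T * (β * T) := by rw [hθ]; field_simp
            _ ≤ _ := by
              gcongr
              linarith
        · exact mul_nonneg (by linarith) hmu
      gcongr)
  refine le_trans ?_ hrec
  have hsum : e * θ * T ≤ ∑ s ∈ Finset.Ico u t, if s < w then θ else 0 := by
    have h1 : ∑ s ∈ Finset.Ico u w, θ ≤ ∑ s ∈ Finset.Ico u t, if s < w then θ else 0 := by
      rw [← Finset.sum_congr rfl (g := fun s => θ)
        (fun s hs => if_pos (Finset.mem_Ico.1 hs).2)]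
      exact Finset.sum_le_sum_of_subset_of_nonneg (Finset.Ico_subset_Ico_right hwt)
        fun s _ _ => by split_ifs <;> linarith
    refine le_trans ?_ h1
    rw [Finset.sum_const, Nat.card_Ico, nsmul_eq_mul, Nat.cast_sub huw']
    nlinarith
  have hexp : Real.exp (-(4 / (p * c))) ≤ (1 - κ) ^ (t - u) := by
    refine exp_le_one_sub_pow hκ0 hκ1 ?_
    have h1 : ((t - u : ℕ) : ℝ) ≤ T := by exact_mod_cast (Nat.sub_le _ _).trans htT
    calc 2 * κ * ((t - u : ℕ) : ℝ) ≤ 2 * κ * T := by gcongr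
      _ = 4 / (p * c) := by rw [hκ]; field_simp; ring
  have hpow : 0 ≤ (1 - κ) ^ (t - u) := pow_nonneg (by linarith) _
  rw [mul_assoc]
  gcongr

/-! ### The estimates -/

/-- The leaf counts `x` are close to their means under the parameters `a`, and are possible in the
model. -/
structure IsTypical (y : ℕ → Bool) (a : ℕ → ℝ) (T : ℕ) (ε : ℝ) (x : ℕ → ℕ) : Prop where
  abs_sub_le : ∀ t ≤ T, |(x t : ℝ) - meanLeaves y a t| ≤ ε * T
  condMean_eq : ∀ t₀ t₁, t₀ ≤ t₁ → t₀ ≤ T → ∀ α : ℝ, -1 < α →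
    condMean y t₀ t₁ x α = meanFrom y t₀ (x t₀) (fun _ => α) t₁

theorem IsTypical.mono {y : ℕ → Bool} {a : ℕ → ℝ} {T : ℕ} {ε ε' : ℝ} {x : ℕ → ℕ}
    (h : IsTypical y a T ε x) (hε : ε ≤ ε') : IsTypical y a T ε' x where
  abs_sub_le t ht := (h.abs_sub_le t ht).trans (by gcongr)
  condMean_eq := h.condMean_eq

/-- By the intermediate value theorem some parameter reproduces `x t₁` exactly. The least squares
minimum is then zero, so every minimizer is a root, and monotonicity traps all roots strictly
between `lo` and `hi`. -/
theorem IsTypical.estimate_mem_Ioo {y : ℕ → Bool} {a : ℕ → ℝ} {T : ℕ} {ε : ℝ} {x : ℕ → ℕ}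
    (h : IsTypical y a T ε x) {est : ℕ → ℕ → ℝ} (hest : IsEstimator y x est) {t₀ t₁ : ℕ}
    (h₀₁ : t₀ ≤ t₁) (h₀ : t₀ ≤ T) {lo hi : ℝ} (hlo : -1 < lo) (hhi : -1 < hi)
    (hxlo : x t₁ < meanFrom y t₀ (x t₀) (fun _ => lo) t₁)
    (hxhi : meanFrom y t₀ (x t₀) (fun _ => hi) t₁ < x t₁) :
    est t₀ t₁ ∈ Set.Ioo lo hi := by
  have hx : (0 : ℝ) ≤ x t₀ := Nat.cast_nonneg _
  have hanti : ∀ {α β : ℝ}, -1 < α → α ≤ β → meanFrom y t₀ (x t₀) (fun _ => β) t₁ ≤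
      meanFrom y t₀ (x t₀) (fun _ => α) t₁ := fun hα hαβ =>
    meanFrom_anti (fun _ => hα) hx fun _ _ => hαβ
  have hlohi : lo ≤ hi := by
    by_contra hcon
    have := hanti hhi (not_le.1 hcon).le
    linarith
  have hcont : ContinuousOn (fun α => meanFrom y t₀ (x t₀) (fun _ => α) t₁) (Set.Icc lo hi) :=
    (continuousOn_meanFrom y t₀ (x t₀) t₁).mono fun α hα => hlo.trans_le hα.1
  obtain ⟨α, hα, hαx⟩ := intermediate_value_Icc' hlohi hcont ⟨hxhi.le, hxlo.le⟩
  simp only at hαx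
  have hα1 : -1 < α := hlo.trans_le hα.1
  have hαls : condMean y t₀ t₁ x α = x t₁ := by
    rw [h.condMean_eq t₀ t₁ h₀₁ h₀ α hα1, hαx]
  obtain ⟨hb1, hb2⟩ := hest t₀ t₁ h₀₁ ⟨α, hα1, fun b _ => by
    rw [hαls, sub_self, zero_pow two_ne_zero]; exact sq_nonneg _⟩
  have hroot := hb2 α hα1
  rw [hαls, sub_self, h.condMean_eq t₀ t₁ h₀₁ h₀ _ hb1] at hroot
  have hroot : meanFrom y t₀ (x t₀) (fun _ => est t₀ t₁) t₁ = x t₁ := by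
    nlinarith
  constructor
  · by_contra hcon
    have := hanti hb1 (not_lt.1 hcon)
    linarith
  · by_contra hcon
    have := hanti hhi (not_lt.1 hcon)
    linarith

section Separation

variable {p c e g B : ℝ}

/-- A lower bound for the estimate: the parameters are at least `β` on the interval, and larger by
`g` on a positive fraction. -/
theorem exists_lt_meanFrom (hp : 0 < p) (hc : 0 < c) (he : 0 < e) (hg : 0 < g) (hB : 0 ≤ B) :
    ∃ ρ > 0, ∃ ε > 0, ∃ T₀ : ℕ, ∀ T ≥ T₀, ∀ y, IsDense p T y → ∀ a : ℕ → ℝ, (∀ t, -1 < a t) →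
      (∀ t, a t ≤ B) → ∀ x : ℕ → ℕ, IsTypical y a T ε x → ∀ t₀ t₁ u w : ℕ, t₀ ≤ u →
      c * T ≤ u → u + e * T ≤ w → w ≤ t₁ → t₁ ≤ T → ∀ β : ℝ, -1 < β →
      (∀ s, t₀ < s → s ≤ t₁ → β ≤ a s) → (∀ s, u < s → s ≤ w → β + g ≤ a s) →
      ∀ lo, -1 < lo → lo ≤ β + ρ → x t₁ < meanFrom y t₀ (x t₀) (fun _ => lo) t₁ := by
  obtain ⟨δ, hδ, T₁, hT₁⟩ := exists_mul_le_meanLeaves_sub hp hc he hg hB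
  -- Of the separation `δ * T`, shifting the parameter by `ρ = δ / 16` costs at most `δ * T / 4`,
  -- and the deviations at `t₀` and `t₁` cost `δ * T / 8` each.
  refine ⟨δ / 16, by positivity, δ / 8, by positivity, max T₁ 1, ?_⟩
  intro T hT y hy a ha haB x hx t₀ t₁ u w htu hu huw hw ht β hβ hab hgap lo hlo hlo'
  have hT0 : (1 : ℝ) ≤ T := by exact_mod_cast (le_max_right _ _).trans hT
  have huw' : u ≤ w := by
    have : (u : ℝ) ≤ w := by nlinarith
    exact_mod_cast this
  have h01 : t₀ ≤ t₁ := htu.trans (huw'.trans hw)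
  have hsplice : ∀ s, t₀ < s → splice a t₀ β s = β := fun s hs => by
    rw [splice, if_neg (by omega)]
  have h1 := hT₁ T ((le_max_left _ _).trans hT) y hy (splice a t₀ β) a (splice_gt ha t₀ hβ) haB
    u w t₁ hu huw hw ht
    (fun s hs => by
      rcases le_or_gt s t₀ with h | h
      · simp [splice, h]
      · rw [hsplice s h]; exact hab s h hs)
    (fun s hs1 hs2 => by rw [hsplice s (by omega)]; exact hgap s hs1 hs2)
  -- Below `β` monotonicity suffices, so only a parameter within `ρ` above `β` needs the Lipschitz
  -- bound.
  set lo' := max lo β with hlodef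
  have hlo1 : -1 < lo' := hlo.trans_le (le_max_left _ _)
  have hlo2 : |splice a t₀ β t₀ - splice a t₀ lo' t₀| ≤ δ / 16 := by
    simp [splice]; positivity
  have hdist : |β - lo'| ≤ δ / 16 := by
    rw [abs_sub_comm, abs_of_nonneg (by linarith [le_max_right lo β])]
    have : lo' ≤ β + δ / 16 := max_le hlo' (by linarith)
    linarith
  have h2 := abs_meanLeaves_sub_le (y := y) (t := t₁) (η := δ / 16) (splice_gt ha t₀ hβ)
    (splice_gt ha t₀ hlo1) (fun s _ => by
      unfold splice; split_ifs
      · simp; positivity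
      · exact hdist)
  have h3 := abs_meanFrom_sub_meanLeaves_splice_le (y := y) (a := a) h01 (x t₀) hlo1
  have h4 := hx.abs_sub_le t₀ (h01.trans ht)
  have h5 := hx.abs_sub_le t₁ ht
  have h6 : meanFrom y t₀ (x t₀) (fun _ => lo') t₁ ≤ meanFrom y t₀ (x t₀) (fun _ => lo) t₁ :=
    meanFrom_anti (fun _ => hlo) (Nat.cast_nonneg _) fun _ _ => le_max_left _ _
  have ht' : (t₁ : ℝ) ≤ T := by exact_mod_cast ht
  have h7 : 4 * (t₁ : ℝ) * (δ / 16) ≤ δ / 4 * T := by nlinarith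
  have h8 : 0 < δ * T := by positivity
  have := (abs_le.1 h2).2
  have := (abs_le.1 (h3.trans h4)).1
  have := (abs_le.1 h5).2
  linarith

/-- An upper bound for the estimate: the parameters are at most `β` on the interval, and smaller by
`g` on a positive fraction. -/
theorem exists_meanFrom_lt (hp : 0 < p) (hc : 0 < c) (he : 0 < e) (hg : 0 < g) (hB : 0 ≤ B) :
    ∃ ρ > 0, ∃ ε > 0, ∃ T₀ : ℕ, ∀ T ≥ T₀, ∀ y, IsDense p T y → ∀ a : ℕ → ℝ, (∀ t, -1 < a t) →
      (∀ t, a t ≤ B) → ∀ x : ℕ → ℕ, IsTypical y a T ε x → ∀ t₀ t₁ u w : ℕ, t₀ ≤ u →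
      c * T ≤ u → u + e * T ≤ w → w ≤ t₁ → t₁ ≤ T → ∀ β : ℝ, -1 < β → β ≤ B →
      (∀ s, t₀ < s → s ≤ t₁ → a s ≤ β) → (∀ s, u < s → s ≤ w → a s + g ≤ β) →
      ∀ hi, -1 < hi → β - ρ ≤ hi → meanFrom y t₀ (x t₀) (fun _ => hi) t₁ < x t₁ := by
  obtain ⟨δ, hδ, T₁, hT₁⟩ := exists_mul_le_meanLeaves_sub hp hc he hg hB
  refine ⟨δ / 16, by positivity, δ / 8, by positivity, max T₁ 1, ?_⟩
  intro T hT y hy a ha haB x hx t₀ t₁ u w htu hu huw hw ht β hβ hβB hab hgap hi hhi hhi'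
  have hT0 : (1 : ℝ) ≤ T := by exact_mod_cast (le_max_right _ _).trans hT
  have huw' : u ≤ w := by
    have : (u : ℝ) ≤ w := by nlinarith
    exact_mod_cast this
  have h01 : t₀ ≤ t₁ := htu.trans (huw'.trans hw)
  have hsplice : ∀ s, t₀ < s → splice a t₀ β s = β := fun s hs => by
    rw [splice, if_neg (by omega)]
  have h1 := hT₁ T ((le_max_left _ _).trans hT) y hy a (splice a t₀ β) ha
    (fun s => by
      unfold splice; split_ifs
      · exact haB s
      · exact hβB)
    u w t₁ hu huw hw ht
    (fun s hs => by
      rcases le_or_gt s t₀ with h | h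
      · simp [splice, h]
      · rw [hsplice s h]; exact hab s h hs)
    (fun s hs1 hs2 => by rw [hsplice s (by omega)]; exact hgap s hs1 hs2)
  set hi' := min hi β with hhidef
  have hhi1 : -1 < hi' := lt_min hhi hβ
  have hdist : |β - hi'| ≤ δ / 16 := by
    rw [abs_of_nonneg (by linarith [min_le_right hi β])]
    have : β - δ / 16 ≤ hi' := le_min hhi' (by linarith)
    linarith
  have h2 := abs_meanLeaves_sub_le (y := y) (t := t₁) (η := δ / 16) (splice_gt ha t₀ hβ)
    (splice_gt ha t₀ hhi1) (fun s _ => by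
      unfold splice; split_ifs
      · simp; positivity
      · exact hdist)
  have h3 := abs_meanFrom_sub_meanLeaves_splice_le (y := y) (a := a) h01 (x t₀) hhi1
  have h4 := hx.abs_sub_le t₀ (h01.trans ht)
  have h5 := hx.abs_sub_le t₁ ht
  have h6 : meanFrom y t₀ (x t₀) (fun _ => hi) t₁ ≤ meanFrom y t₀ (x t₀) (fun _ => hi') t₁ :=
    meanFrom_anti (fun _ => hhi1) (Nat.cast_nonneg _) fun _ _ => min_le_left _ _
  have ht' : (t₁ : ℝ) ≤ T := by exact_mod_cast ht
  have h7 : 4 * (t₁ : ℝ) * (δ / 16) ≤ δ / 4 * T := by nlinarith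
  have h8 : 0 < δ * T := by positivity
  have := (abs_le.1 h2).1
  have := (abs_le.1 (h3.trans h4)).2
  have := (abs_le.1 h5).1
  linarith

/-- The estimate from an interval is close to the parameter if that is constant. If the parameter
takes values in `[α, β]`, and one of the end points on a positive fraction of the interval, the
estimate is bounded away from the other end point. -/
theorem exists_estimate_bounds (hp : 0 < p) (hc : 0 < c) (he : 0 < e) (hg : 0 < g) (hB : 0 ≤ B) :
    ∃ ρ > 0, ∀ η > 0, ∃ ε > 0, ∃ T₀ : ℕ, ∀ T ≥ T₀, ∀ y, IsDense p T y → ∀ a : ℕ → ℝ,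
      (∀ t, -1 < a t) → (∀ t, a t ≤ B) → ∀ x : ℕ → ℕ, IsTypical y a T ε x →
      ∀ est, IsEstimator y x est → ∀ t₀ t₁ u w : ℕ, t₀ ≤ u →
      c * T ≤ u → u + e * T ≤ w → w ≤ t₁ → t₁ ≤ T →
      ∀ α β : ℝ, -1 < α - η → β + η ≤ B → (∀ s, t₀ < s → s ≤ t₁ → α ≤ a s ∧ a s ≤ β) →
        (α = β → est t₀ t₁ ∈ Set.Ioo (α - η) (α + η)) ∧
        (α + g ≤ β → (∀ s, u < s → s ≤ w → a s = β) → est t₀ t₁ ∈ Set.Ioo (α + ρ) (β + η)) ∧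
        (α + g ≤ β → (∀ s, u < s → s ≤ w → a s = α) → est t₀ t₁ ∈ Set.Ioo (α - η) (β - ρ)) := by
  obtain ⟨ρ₁, hρ₁, ε₁, hε₁, T₁, h₁⟩ := exists_lt_meanFrom hp hc he hg hB
  obtain ⟨ρ₂, hρ₂, ε₂, hε₂, T₂, h₂⟩ := exists_meanFrom_lt hp hc he hg hB
  -- The bound `ρ ≤ g` keeps `β - ρ ≥ α` inside the parameter space. `ρ` is fixed before `η`, so
  -- that `η` can later be taken small compared with it.
  refine ⟨min (min ρ₁ ρ₂) g, by positivity, fun η hη => ?_⟩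
  -- The same separation lemmas with gap `η` compare the true parameters with the constants `α - η`
  -- and `β + η`; this gives the outer bounds.
  obtain ⟨ρ₃, hρ₃, ε₃, hε₃, T₃, h₃⟩ := exists_lt_meanFrom hp hc he hη hB
  obtain ⟨ρ₄, hρ₄, ε₄, hε₄, T₄, h₄⟩ := exists_meanFrom_lt hp hc he hη hB
  refine ⟨min (min ε₁ ε₂) (min ε₃ ε₄), by positivity, max (max T₁ T₂) (max T₃ T₄), ?_⟩
  intro T hT y hy a ha haB x hx est hest t₀ t₁ u w htu hu huw hw ht α β hα hβ hab
  have hT0 : (0 : ℝ) ≤ T := Nat.cast_nonneg _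
  have huw' : u ≤ w := by
    have : (u : ℝ) ≤ w := by nlinarith
    exact_mod_cast this
  have h01 : t₀ ≤ t₁ := htu.trans (huw'.trans hw)
  have hin : ∀ s, u < s → s ≤ w → α ≤ a s ∧ a s ≤ β := fun s hs1 hs2 =>
    hab s (by omega) (hs2.trans hw)
  have hρ1 : min (min ρ₁ ρ₂) g ≤ ρ₁ := (min_le_left _ _).trans (min_le_left _ _)
  have hρ2 : min (min ρ₁ ρ₂) g ≤ ρ₂ := (min_le_left _ _).trans (min_le_right _ _)
  have hρ3 : min (min ρ₁ ρ₂) g ≤ g := min_le_right _ _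
  have hρ0 : 0 < min (min ρ₁ ρ₂) g := by positivity
  set ρ := min (min ρ₁ ρ₂) g
  have ht1 : T₁ ≤ T := (le_max_left _ _).trans ((le_max_left _ _).trans hT)
  have ht2 : T₂ ≤ T := (le_max_right _ _).trans ((le_max_left _ _).trans hT)
  have ht3 : T₃ ≤ T := (le_max_left _ _).trans ((le_max_right _ _).trans hT)
  have ht4 : T₄ ≤ T := (le_max_right _ _).trans ((le_max_right _ _).trans hT)
  have hx1 : IsTypical y a T ε₁ x := hx.mono ((min_le_left _ _).trans (min_le_left _ _))
  have hx2 : IsTypical y a T ε₂ x := hx.mono ((min_le_left _ _).trans (min_le_right _ _))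
  have hx3 : IsTypical y a T ε₃ x := hx.mono ((min_le_right _ _).trans (min_le_left _ _))
  have hx4 : IsTypical y a T ε₄ x := hx.mono ((min_le_right _ _).trans (min_le_right _ _))
  have hlow : x t₁ < meanFrom y t₀ (x t₀) (fun _ => α - η) t₁ :=
    h₃ T ht3 y hy a ha haB x hx3 t₀ t₁ u w htu hu huw hw ht (α - η) hα
      (fun s hs1 hs2 => by linarith [(hab s hs1 hs2).1])
      (fun s hs1 hs2 => by linarith [(hin s hs1 hs2).1]) (α - η) hα (by linarith)
  have hαβ : α ≤ β := by
    rcases h01.lt_or_eq with h | h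
    · exact (hab t₁ h le_rfl).1.trans (hab t₁ h le_rfl).2
    · exfalso
      have h6 : u = w := by omega
      have h7 : 0 < T := by
        by_contra h0
        have : t₁ = 0 := by omega
        have : T = 0 := by omega
        subst h
        rw [meanFrom_of_le y _ _ le_rfl] at hlow
        exact lt_irrefl _ hlow
      rw [h6] at huw
      have : (0 : ℝ) < T := by exact_mod_cast h7
      nlinarith
  have hupp : meanFrom y t₀ (x t₀) (fun _ => β + η) t₁ < x t₁ :=
    h₄ T ht4 y hy a ha haB x hx4 t₀ t₁ u w htu hu huw hw ht (β + η) (by linarith) hβ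
      (fun s hs1 hs2 => by linarith [(hab s hs1 hs2).2])
      (fun s hs1 hs2 => by linarith [(hin s hs1 hs2).2]) (β + η) (by linarith) (by linarith)
  refine ⟨fun h => ?_, fun hgap heq => ?_, fun hgap heq => ?_⟩
  · subst h
    exact hx.estimate_mem_Ioo hest h01 (h01.trans ht) hα (by linarith) hlow hupp
  · refine hx.estimate_mem_Ioo hest h01 (h01.trans ht) (by linarith) (by linarith) ?_ hupp
    exact h₁ T ht1 y hy a ha haB x hx1 t₀ t₁ u w htu hu huw hw ht α (by linarith)
      (fun s hs1 hs2 => (hab s hs1 hs2).1) (fun s hs1 hs2 => by rw [heq s hs1 hs2]; exact hgap)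
      _ (by linarith) (by linarith)
  · refine hx.estimate_mem_Ioo hest h01 (h01.trans ht) hα (by linarith) hlow ?_
    exact h₂ T ht2 y hy a ha haB x hx2 t₀ t₁ u w htu hu huw hw ht β (by linarith) (by linarith)
      (fun s hs1 hs2 => (hab s hs1 hs2).2) (fun s hs1 hs2 => by rw [heq s hs1 hs2]; exact hgap)
      _ (by linarith) (by linarith)

end Separation

/-! ### The threshold for the statistic -/

/-- The statistic separates the intervals that contain the change point from those that are far from
it. -/
theorem exists_splitStat_threshold {p c e α₁ α₂ : ℝ} (hp : 0 < p) (hc : 0 < c) (he : 0 < e)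
    (hα₁ : -1 < α₁) (hα₂ : -1 < α₂) (hα : α₁ ≠ α₂) :
    ∃ γ : ℝ, ∃ ε > 0, ∃ T₀ : ℕ, ∀ T ≥ T₀, ∀ y, IsDense p T y → ∀ R : ℕ, c * T ≤ R →
      (R : ℝ) ≤ T → ∀ x : ℕ → ℕ, IsTypical y (changeParam α₁ α₂ R) T ε x → ∀ est,
      IsEstimator y x est → ∀ s t : ℝ, c * T ≤ s → s ≤ t → t + c * T ≤ T →
        (s ≤ R → R ≤ t → γ ≤ splitStat est T s t) ∧
        (R + e * T ≤ s ∨ t + e * T ≤ R → splitStat est T s t < γ) := by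
  set g := |α₁ - α₂| with hg
  have hg0 : 0 < g := abs_pos.2 (sub_ne_zero.2 hα)
  set B := |α₁| + |α₂| + g with hBdef
  have hB0 : 0 ≤ B := by positivity
  have hB1 : α₁ + g ≤ B := by
    have := le_abs_self α₁; have := abs_nonneg α₂; rw [hBdef]; linarith
  have hB2 : α₂ + g ≤ B := by
    have := le_abs_self α₂; have := abs_nonneg α₁; rw [hBdef]; linarith
  -- The halved and quartered lengths leave room for rounding `s` and `t` to integer times.
  set e' := min (e / 2) (c / 4) with he'
  have he'0 : 0 < e' := by positivity
  have he'1 : e' ≤ e / 2 := min_le_left _ _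
  have he'2 : e' ≤ c / 4 := min_le_right _ _
  obtain ⟨ρ, hρ, hη⟩ := exists_estimate_bounds (B := B) hp (show 0 < c / 4 by positivity) he'0 hg0
    hB0
  -- For a far interval the signed difference of the estimates, in the direction of the change, lies
  -- between `-2 * η` and `g - ρ + η`. The bounds `g / 4` and `ρ / 3` put both within `g - 2 * η` in
  -- absolute value; the remaining ones keep `α₁ - η` and `α₂ - η` above `-1`.
  set η := min (min (ρ / 3) (g / 4)) (min ((1 + α₁) / 2) ((1 + α₂) / 2)) with hηdef
  have hη0 : 0 < η := by
    have : 0 < 1 + α₁ := by linarith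
    have : 0 < 1 + α₂ := by linarith
    positivity
  have hη1 : η ≤ ρ / 3 := (min_le_left _ _).trans (min_le_left _ _)
  have hη2 : η ≤ g / 4 := (min_le_left _ _).trans (min_le_right _ _)
  have hη3 : η ≤ (1 + α₁) / 2 := (min_le_right _ _).trans (min_le_left _ _)
  have hη4 : η ≤ (1 + α₂) / 2 := (min_le_right _ _).trans (min_le_right _ _)
  obtain ⟨ε, hε, T₁, hT₁⟩ := hη η hη0
  refine ⟨g - 2 * η, ε, hε, max T₁ ⌈max (8 / c) (4 / e)⌉₊, ?_⟩
  intro T hT y hy R hRc hRT x hx est hest s t hs hst ht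
  have hT' := (Nat.le_ceil _).trans
    (show ((_ : ℕ) : ℝ) ≤ (T : ℝ) from Nat.cast_le.2 ((le_max_right _ _).trans hT))
  have hT2 : 8 / c ≤ T := (le_max_left _ _).trans hT'
  have hT3 : 4 / e ≤ T := (le_max_right _ _).trans hT'
  rw [div_le_iff₀ (by positivity), mul_comm] at hT2 hT3
  have hT0 : (0 : ℝ) ≤ T := Nat.cast_nonneg _
  have heT : e' * T ≤ e / 2 * T := by gcongr
  have hecT : e' * T ≤ c / 4 * T := by gcongr
  have heT0 : 0 ≤ e * T := by positivity
  have hcT0 : 0 ≤ c * T := by positivity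
  have hs0 : 0 < s := by linarith
  have ha : ∀ n, -1 < changeParam α₁ α₂ R n := fun n => by
    unfold changeParam; split_ifs <;> assumption
  have haB : ∀ n, changeParam α₁ α₂ R n ≤ B := fun n => by
    unfold changeParam; split_ifs <;> linarith
  have haR : ∀ n, n < R → changeParam α₁ α₂ R n = α₁ := fun n hn => if_pos hn
  have haR' : ∀ n, R ≤ n → changeParam α₁ α₂ R n = α₂ := fun n hn => if_neg (by omega)
  set n₁ := ⌈s⌉₊ - 1 with hn₁
  set n₂ := ⌈t⌉₊ with hn₂
  have hceil : 0 < ⌈s⌉₊ := Nat.ceil_pos.2 hs0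
  have hn1s : (n₁ : ℝ) < s := Nat.lt_ceil.1 (by omega)
  have hn1s' : s ≤ n₁ + 1 := by
    have h1 := Nat.le_ceil s
    have h2 : ⌈s⌉₊ = n₁ + 1 := by omega
    rw [h2] at h1
    exact_mod_cast h1
  have hn2t : t ≤ n₂ := Nat.le_ceil t
  have hn2t' : (n₂ : ℝ) < t + 1 := Nat.ceil_lt_add_one (by linarith)
  have hn1T : n₁ ≤ T := by
    have : (n₁ : ℝ) ≤ T := by linarith
    exact_mod_cast this
  have hall := hT₁ T ((le_max_left _ _).trans hT) y hy _ ha haB x hx est hest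
  -- the estimate from the times before `s`
  have hA : s ≤ R → est 0 n₁ ∈ Set.Ioo (α₁ - η) (α₁ + η) := by
    intro hsR
    have hu := Nat.le_ceil (c / 4 * T)
    have hu' := Nat.ceil_lt_add_one (show 0 ≤ c / 4 * (T : ℝ) by positivity)
    refine (hall 0 n₁ ⌈c / 4 * (T : ℝ)⌉₊ n₁ (Nat.zero_le _) hu (by linarith) le_rfl hn1T α₁ α₁
      (by linarith) (by linarith) fun i _ hi => ?_).1 rfl
    rw [haR i]
    · exact ⟨le_rfl, le_rfl⟩
    · have : (n₁ : ℝ) < R := by linarith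
      have : n₁ < R := by exact_mod_cast this
      omega
  -- the estimate from the times after `t`
  have hB : (R : ℝ) ≤ t → est n₂ T ∈ Set.Ioo (α₂ - η) (α₂ + η) := by
    intro hRt
    refine (hall n₂ T n₂ T le_rfl (by linarith) (by linarith) le_rfl le_rfl α₂ α₂
      (by linarith) (by linarith) fun i hi _ => ?_).1 rfl
    rw [haR' i]
    · exact ⟨le_rfl, le_rfl⟩
    · have : (R : ℝ) ≤ n₂ := by linarith
      have : R ≤ n₂ := by exact_mod_cast this
      omega
  have hmix : ∀ i, min α₁ α₂ ≤ changeParam α₁ α₂ R i ∧ changeParam α₁ α₂ R i ≤ max α₁ α₂ := by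
    intro i
    unfold changeParam
    split_ifs
    · exact ⟨min_le_left _ _, le_max_left _ _⟩
    · exact ⟨min_le_right _ _, le_max_right _ _⟩
  have hmin : -1 < min α₁ α₂ - η := by
    rcases min_choice α₁ α₂ with h | h <;> rw [h] <;> linarith
  have hmax : max α₁ α₂ + η ≤ B := by
    rcases max_choice α₁ α₂ with h | h <;> rw [h] <;> linarith
  -- The first estimate now uses a positive fraction of times with parameter `α₂`, which keeps it at
  -- least `ρ` away from `α₁`.
  have hC : R + e * T ≤ s →
      (α₁ < α₂ → est 0 n₁ ∈ Set.Ioo (α₁ + ρ) (α₂ + η)) ∧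
      (α₂ < α₁ → est 0 n₁ ∈ Set.Ioo (α₂ - η) (α₁ - ρ)) := by
    intro hRs
    have h := hall 0 n₁ R n₁ (Nat.zero_le _) (by linarith) (by linarith) le_rfl hn1T _ _ hmin hmax
      fun i _ _ => hmix i
    constructor
    · intro hlt
      rw [min_eq_left hlt.le, max_eq_right hlt.le] at h
      refine h.2.1 ?_ fun i hi _ => haR' i hi.le
      rw [hg, abs_sub_comm, abs_of_pos (by linarith)]; linarith
    · intro hlt
      rw [min_eq_right hlt.le, max_eq_left hlt.le] at h
      refine h.2.2 ?_ fun i hi _ => haR' i hi.le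
      rw [hg, abs_of_pos (by linarith)]; linarith
  have hD : t + e * T ≤ R →
      (α₁ < α₂ → est n₂ T ∈ Set.Ioo (α₁ - η) (α₂ - ρ)) ∧
      (α₂ < α₁ → est n₂ T ∈ Set.Ioo (α₂ + ρ) (α₁ + η)) := by
    intro htR
    have hR1 : 1 ≤ R := by
      have : (0 : ℝ) < R := by linarith
      have : 0 < R := by exact_mod_cast this
      omega
    have hRT' : R ≤ T := by exact_mod_cast hRT
    -- The stretch ends at `R - 1` because the parameter at time `R` is already `α₂`.
    have h := hall n₂ T n₂ (R - 1) le_rfl (by linarith) (by push_cast [hR1]; linarith) (by omega)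
      le_rfl _ _ hmin hmax fun i _ _ => hmix i
    constructor
    · intro hlt
      rw [min_eq_left hlt.le, max_eq_right hlt.le] at h
      refine h.2.2 ?_ fun i _ hi => haR i (by omega)
      rw [hg, abs_sub_comm, abs_of_pos (by linarith)]; linarith
    · intro hlt
      rw [min_eq_right hlt.le, max_eq_left hlt.le] at h
      refine h.2.1 ?_ fun i _ hi => haR i (by omega)
      rw [hg, abs_of_pos (by linarith)]; linarith
  change (_ → _ → _ ≤ |est 0 n₁ - est n₂ T|) ∧ (_ → |est 0 n₁ - est n₂ T| < _)
  have hgcase : (α₁ < α₂ ∧ g = α₂ - α₁) ∨ (α₂ < α₁ ∧ g = α₁ - α₂) := by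
    rcases lt_or_gt_of_ne hα with h | h
    · exact Or.inl ⟨h, by rw [hg, abs_sub_comm, abs_of_pos (by linarith)]⟩
    · exact Or.inr ⟨h, by rw [hg, abs_of_pos (by linarith)]⟩
  refine ⟨fun hsR hRt => ?_, ?_⟩
  · obtain ⟨h1, h2⟩ := hA hsR
    obtain ⟨h3, h4⟩ := hB hRt
    rcases hgcase with ⟨_, h⟩ | ⟨_, h⟩
    · exact le_trans (by linarith) (neg_le_abs _)
    · exact le_trans (by linarith) (le_abs_self _)
  · rintro (hRs | htR)
    · obtain ⟨h1, h2⟩ := hB (by linarith)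
      rw [abs_lt]
      rcases hgcase with ⟨hlt, h⟩ | ⟨hlt, h⟩
      · obtain ⟨h3, h4⟩ := (hC hRs).1 hlt
        constructor <;> linarith
      · obtain ⟨h3, h4⟩ := (hC hRs).2 hlt
        constructor <;> linarith
    · obtain ⟨h1, h2⟩ := hA (by linarith)
      rw [abs_lt]
      rcases hgcase with ⟨hlt, h⟩ | ⟨hlt, h⟩
      · obtain ⟨h3, h4⟩ := (hD htR).1 hlt
        constructor <;> linarith
      · obtain ⟨h3, h4⟩ := (hD htR).2 hlt
        constructor <;> linarith

/-! ### The detection procedure -/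

section Detection

variable {k : ℕ} {l r δ : ℝ} {b : ℕ → ℝ}

theorem IsDivision.add_le (h : IsDivision k l r δ b) (hδ : 0 ≤ δ) {i j : ℕ} (hij : i < j)
    (hj : j ≤ k) : b i + δ ≤ b j := by
  induction j, hij using Nat.le_induction with
  | base => linarith [h.2.2 i (by omega)]
  | succ j hij ih => linarith [h.2.2 j (by omega), ih (by omega)]

theorem IsDivision.le (h : IsDivision k l r δ b) (hδ : 0 ≤ δ) {i j : ℕ} (hij : i ≤ j)
    (hj : j ≤ k) : b i ≤ b j := by
  rcases hij.lt_or_eq with hij | rfl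
  · linarith [h.add_le hδ hij hj]
  · exact le_rfl

theorem exists_mem_block {b : ℕ → ℝ} {m n : ℕ} (hmn : m ≤ n) {R : ℝ}
    (hl : b (m - 1) ≤ R) (hr : R ≤ b n) : ∃ i ∈ Finset.Icc m n, b (i - 1) ≤ R ∧ R ≤ b i := by
  induction n, hmn using Nat.le_induction with
  | base => exact ⟨m, by simp, hl, hr⟩
  | succ n hn ih =>
    rcases le_total R (b n) with h | h
    · obtain ⟨i, hi, h'⟩ := ih h
      rw [Finset.mem_Icc] at hi
      exact ⟨i, Finset.mem_Icc.2 ⟨hi.1, by omega⟩, h'⟩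
    · exact ⟨n + 1, Finset.mem_Icc.2 ⟨by omega, le_rfl⟩, h, hr⟩

/-- The union of three consecutive blocks around the block `j` among the blocks `m, …, n`. -/
theorem exists_enclosing_blocks (h : IsDivision k l r δ b) (hδ : 0 < δ) {m n j : ℕ} (hm : 1 ≤ m)
    (hmn : m + 2 ≤ n) (hn : n ≤ k) (hj : j ∈ Finset.Icc m n) {R : ℝ} (hl : b (m - 1) ≤ R)
    (hr : R ≤ b n) (hj1 : b (j - 1) < R + δ) (hj2 : R < b j + δ) {V : ℝ × ℝ}
    (hV : V = if j = m then (b (m - 1), b (m + 2)) else if j = n then (b (n - 3), b n)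
      else (b (j - 2), b (j + 1))) :
    b (m - 1) ≤ V.1 ∧ V.1 + δ ≤ V.2 ∧ V.2 ≤ b n ∧ V.1 ≤ R ∧ R ≤ V.2 ∧ (R < b n → R < V.2) := by
  rw [Finset.mem_Icc] at hj
  split_ifs at hV with h1 h2
  · subst h1 hV
    have h3 := h.add_le hδ.le (show j < j + 2 by omega) (by omega)
    have h4 := h.add_le hδ.le (show j - 1 < j + 2 by omega) (by omega)
    exact ⟨le_rfl, h4, h.le hδ.le hmn hn, hl, by simp only; linarith, fun _ => by simp only; linarith⟩
  · subst h2 hV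
    have h3 := h.add_le hδ.le (show j - 3 < j - 1 by omega) (by omega)
    have h4 := h.add_le hδ.le (show j - 3 < j by omega) (by omega)
    exact ⟨h.le hδ.le (by omega) (by omega), h4, le_rfl, by simp only; linarith, hr, id⟩
  · subst hV
    have h3 := h.add_le hδ.le (show j - 2 < j - 1 by omega) (by omega)
    have h4 := h.add_le hδ.le (show j < j + 1 by omega) (by omega)
    have h5 := h.add_le hδ.le (show j - 2 < j + 1 by omega) (by omega)
    exact ⟨h.le hδ.le (by omega) (by omega), h5, h.le hδ.le (by omega) hn, by simp only; linarith,
      by simp only; linarith, fun _ => by simp only; linarith⟩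

/-- Some block contains `R` and scores at least `γ`; the maximizer scores no less, so it cannot be
far from `R`. -/
theorem IsArgmax.near {est : ℕ → ℕ → ℝ} {T : ℕ} {m n j : ℕ} (hj : IsArgmax est T b m n j)
    (hmn : m ≤ n) {R γ : ℝ} (hl : b (m - 1) ≤ R) (hr : R ≤ b n)
    (hstat : ∀ i ∈ Finset.Icc m n,
      (b (i - 1) ≤ R → R ≤ b i → γ ≤ splitStat est T (b (i - 1)) (b i)) ∧
      (R + δ ≤ b (i - 1) ∨ b i + δ ≤ R → splitStat est T (b (i - 1)) (b i) < γ)) :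
    b (j - 1) < R + δ ∧ R < b j + δ := by
  obtain ⟨i, hi, hi1, hi2⟩ := exists_mem_block hmn hl hr
  have h1 := ((hstat i hi).1 hi1 hi2).trans (hj.2 i hi)
  have h2 : ¬ (R + δ ≤ b (j - 1) ∨ b j + δ ≤ R) :=
    fun hcon => not_lt.2 h1 ((hstat j hj.1).2 hcon)
  rw [not_or, not_le, not_le] at h2
  exact h2

/-- If the statistic exceeds `γ` on the intervals that contain `R`, and only on intervals near `R`,
the detected intervals contain `R`. -/
theorem detected_subset {est : ℕ → ℕ → ℝ} {T Q : ℕ} {s : ℕ → ℝ} {c R γ : ℝ}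
    {div : ℕ → ℝ → ℝ → ℕ → ℝ} (hT : 0 < T) (hc : 0 < c) (hk : 5 ≤ k)
    (hs : IsDivision k 0 T (c * T) s)
    (hdiv : ∀ (d : ℕ) (l r : ℝ), 0 ≤ l → l < r → r ≤ T →
      IsDivision k l r (c * (r - l)) (div d l r))
    (hR1 : s 1 ≤ R) (hR2 : R ≤ s (k - 1))
    (hstat : ∀ x z : ℝ, s 1 ≤ x → x ≤ z → z ≤ s (k - 1) →
      (x ≤ R → R ≤ z → γ ≤ splitStat est T x z) ∧
      (R + c ^ (Q + 2) * T ≤ x ∨ z + c ^ (Q + 2) * T ≤ R → splitStat est T x z < γ))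
    (d : ℕ) (hd : d ≤ Q) (V : ℝ × ℝ) (hV : V ∈ detected est T k s div d) :
    s 1 ≤ V.1 ∧ V.1 + c ^ (d + 1) * T ≤ V.2 ∧ V.2 ≤ s (k - 1) ∧ V.1 ≤ R ∧ R ≤ V.2 ∧
      (R < s (k - 1) → R < V.2) := by
  have hT0 : (0 : ℝ) < T := by exact_mod_cast hT
  have hcT : 0 < c * T := by positivity
  -- A block of length at least `c * T` fits into `[0, T)`. Hence powers of `c` decrease, and `c ^
  -- (Q + 2) * T` is below the block length of every stage.
  have hc1 : c ≤ 1 := by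
    have h1 := hs.add_le hcT.le (show 0 < k by omega) le_rfl
    rw [hs.1, hs.2.1, zero_add] at h1
    exact le_of_mul_le_mul_right (by rwa [one_mul]) hT0
  have hfar : ∀ {δ x z : ℝ}, c ^ (Q + 2) * T ≤ δ → s 1 ≤ x → x ≤ z → z ≤ s (k - 1) →
      (x ≤ R → R ≤ z → γ ≤ splitStat est T x z) ∧
      (R + δ ≤ x ∨ z + δ ≤ R → splitStat est T x z < γ) := by
    intro δ x z hδ hx hxz hz
    refine ⟨(hstat x z hx hxz hz).1, fun h => (hstat x z hx hxz hz).2 ?_⟩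
    exact h.imp (fun h => by linarith) fun h => by linarith
  induction d generalizing V with
  | zero =>
    obtain ⟨j, hj, hVj⟩ := hV
    have hδ : c ^ (Q + 2) * T ≤ c * T := by
      gcongr
      exact pow_le_of_le_one hc.le hc1 (by omega)
    obtain ⟨h1, h2⟩ := hj.near (δ := c * T) (γ := γ) (by omega) hR1 hR2 fun i hi => by
      rw [Finset.mem_Icc] at hi
      exact hfar hδ (hs.le hcT.le (by omega) (by omega)) (hs.le hcT.le (by omega) (by omega))
        (hs.le hcT.le (by omega) (by omega))
    rw [zero_add, pow_one]
    refine exists_enclosing_blocks hs hcT (m := 2) (by norm_num) (by omega) (by omega) hj.1 hR1 hR2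
      h1 h2 ?_
    rw [hVj, firstInterval, show k - 1 - 3 = k - 4 by omega]
  | succ d ih =>
    obtain ⟨U, hU, j, hj, hVj⟩ := hV
    obtain ⟨hU1, hU2, hU3, hU4, hU5, hU6⟩ := ih (by omega) U hU
    have hs0 : 0 ≤ s 1 := by
      have := hs.add_le hcT.le (show 0 < 1 by omega) (by omega)
      rw [hs.1] at this; linarith
    have hsT : s (k - 1) ≤ T := by
      rw [← hs.2.1]; exact hs.le hcT.le (by omega) le_rfl
    have hlen : 0 < c ^ (d + 1) * (T : ℝ) := by positivity
    have hD := hdiv d U.1 U.2 (by linarith) (by linarith) (by linarith)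
    have hδ0 : 0 < c * (U.2 - U.1) := mul_pos hc (by linarith)
    -- The new interval is at least as long as one of its blocks, so each stage loses at most a
    -- factor `c`.
    have hδ1 : c ^ (d + 1 + 1) * T ≤ c * (U.2 - U.1) := by
      rw [pow_succ', mul_assoc]
      gcongr
      linarith
    have hδ2 : c ^ (Q + 2) * T ≤ c * (U.2 - U.1) := by
      refine le_trans ?_ hδ1
      gcongr ?_ * _
      exact pow_le_pow_of_le_one hc.le hc1 (by omega)
    set t := div d U.1 U.2
    have ht0 : t (1 - 1) = U.1 := hD.1
    have htk : t k = U.2 := hD.2.1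
    have hin : ∀ i ≤ k, U.1 ≤ t i ∧ t i ≤ U.2 := fun i hi =>
      ⟨by rw [← ht0]; exact hD.le hδ0.le (by omega) hi,
        by rw [← htk]; exact hD.le hδ0.le hi le_rfl⟩
    obtain ⟨h1, h2⟩ := hj.near (δ := c * (U.2 - U.1)) (γ := γ) (R := R) (by omega)
      (by rwa [ht0]) (by rwa [htk]) fun i hi => by
        rw [Finset.mem_Icc] at hi
        exact hfar hδ2 (hU1.trans (hin _ (by omega)).1) (hD.le hδ0.le (by omega) hi.2)
          ((hin _ hi.2).2.trans hU3)
    obtain ⟨h3, h4, h5, h6, h7, h8⟩ := exists_enclosing_blocks hD hδ0 (m := 1) le_rfl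
      (by omega) le_rfl hj.1 (by rwa [ht0]) (by rwa [htk]) h1 h2 hVj
    rw [ht0] at h3
    rw [htk] at h5 h8
    exact ⟨hU1.trans h3, by linarith, h5.trans hU3, h6, h7, fun h => h8 (hU6 h)⟩

end Detection

/-! ### Typical leaf counts have probability tending to one -/

theorem isTypical_of_mem_support {y : ℕ → Bool} {a : ℕ → ℝ} (ha : ∀ t, -1 < a t) {T : ℕ} {ε : ℝ}
    {G : Trajectory} (hG : G ∈ (trajectoryLaw y a T).support)
    (h : ¬ ∃ t ≤ T, ε * T < |(leafCount G t : ℝ) - meanLeaves y a t|) :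
    IsTypical y a T ε (leafCount G) where
  abs_sub_le t ht := by
    by_contra hcon
    exact h ⟨t, ht, not_le.1 hcon⟩
  condMean_eq t₀ t₁ h₀₁ h₀ α hα := condMean_eq_meanFrom ha h₀₁ h₀ hG hα

/-- Events that are implied by typical leaf counts have probability tending to one. -/
theorem tendsto_toMeasure_of_isTypical {ε : ℝ} (hε : 0 < ε) (y : ℕ → ℕ → Bool) (a : ℕ → ℕ → ℝ)
    (ha : ∀ T t, -1 < a T t) (E : ℕ → Set Trajectory)
    (hE : ∀ᶠ T in atTop, ∀ G : Trajectory, IsTypical (y T) (a T) T ε (leafCount G) → G ∈ E T) :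
    Tendsto (fun T => (trajectoryLaw (y T) (a T) T).toMeasure (E T)) atTop (𝓝 1) := by
  obtain ⟨C, hC⟩ := exists_toMeasure_exists_lt_abs_leafCount_sub_le hε
  have hlim : Tendsto (fun T : ℕ => 1 - ENNReal.ofReal (C / T)) atTop (𝓝 1) := by
    have h1 : Tendsto (fun T : ℕ => C / (T : ℝ)) atTop (𝓝 0) := tendsto_const_div_atTop_nhds_zero_nat C
    have h2 := ENNReal.Tendsto.sub (tendsto_const_nhds (x := (1 : ENNReal)))
      (ENNReal.tendsto_ofReal h1) (Or.inl ENNReal.one_ne_top)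
    simpa using h2
  refine tendsto_of_tendsto_of_tendsto_of_le_of_le' hlim tendsto_const_nhds ?_
    (Eventually.of_forall fun T => prob_le_one)
  filter_upwards [hE, eventually_gt_atTop 0] with T hET hT
  set A := {G : Trajectory | ∃ t ≤ T, ε * T < |(leafCount G t : ℝ) - meanLeaves (y T) (a T) t|}
  calc 1 - ENNReal.ofReal (C / T) ≤ 1 - (trajectoryLaw (y T) (a T) T).toMeasure A :=
        tsub_le_tsub_left (hC T (y T) (a T) hT (ha T)) 1
    _ = (trajectoryLaw (y T) (a T) T).toMeasure Aᶜ :=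
        (prob_compl_eq_one_sub (measurableSet_trajectory A)).symm
    _ ≤ _ := PMF.toMeasure_mono _ (measurableSet_trajectory _) fun G hG =>
        hET G (isTypical_of_mem_support (ha T) hG.2 hG.1)

end EvolvingNetwork

/-! ### The proposition -/

theorem proposition3p1
    (p c α₁ α₂ : ℝ) (hp : 0 < p) (hc : 0 < c)
    (hα₁ : -1 < α₁) (hα₂ : -1 < α₂) (hα : α₁ ≠ α₂)
    (y : ℕ → ℕ → Bool)
    (hy : ∀ T t : ℕ, 0 < t → t ≤ T →
      p ≤ (EvolvingNetwork.vertexCount (y T) t : ℝ) / (t : ℝ))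
    (K Q : ℕ) (k q R : ℕ → ℕ)
    (hk : ∀ T, 5 ≤ k T ∧ k T ≤ K) (hq : ∀ T, q T ≤ Q)
    (s : ℕ → ℕ → ℝ)
    (hs : ∀ᶠ T : ℕ in atTop, EvolvingNetwork.IsDivision (k T) 0 T (c * T) (s T))
    (div : ℕ → ℕ → ℝ → ℝ → ℕ → ℝ)
    (hdiv : ∀ (T d : ℕ) (l r : ℝ), 0 ≤ l → l < r → r ≤ T →
      EvolvingNetwork.IsDivision (k T) l r (c * (r - l)) (div T d l r))
    (hR : ∀ᶠ T : ℕ in atTop, s T 1 ≤ (R T : ℝ) ∧ (R T : ℝ) ≤ s T (k T - 1)) :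
    Tendsto (fun T : ℕ =>
        (EvolvingNetwork.trajectoryLaw (y T)
            (EvolvingNetwork.changeParam α₁ α₂ (R T)) T).toMeasure
          (EvolvingNetwork.containsEvent (y T) T (k T) (q T) (s T) (div T) Set.Icc (R T)))
      atTop (𝓝 1) ∧
    ((∀ᶠ T : ℕ in atTop, (R T : ℝ) < s T (k T - 1)) →
      Tendsto (fun T : ℕ =>
          (EvolvingNetwork.trajectoryLaw (y T)
              (EvolvingNetwork.changeParam α₁ α₂ (R T)) T).toMeasure
            (EvolvingNetwork.containsEvent (y T) T (k T) (q T) (s T) (div T) Set.Ico (R T)))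
        atTop (𝓝 1)) := by
  -- A single distance scale, below all block lengths of the stages up to `Q`, yields one threshold
  -- and one typical event for the whole procedure.
  obtain ⟨γ, ε, hε, T₀, hT₀⟩ := EvolvingNetwork.exists_splitStat_threshold hp hc
    (show 0 < c ^ (Q + 2) by positivity) hα₁ hα₂ hα
  have ha : ∀ T t, -1 < EvolvingNetwork.changeParam α₁ α₂ (R T) t := fun T t => by
    unfold EvolvingNetwork.changeParam; split_ifs <;> assumption
  have key : ∀ᶠ T : ℕ in atTop, ∀ G : EvolvingNetwork.Trajectory,
      EvolvingNetwork.IsTypical (y T) (EvolvingNetwork.changeParam α₁ α₂ (R T)) T ε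
        (EvolvingNetwork.leafCount G) →
      ∀ est, EvolvingNetwork.IsEstimator (y T) (EvolvingNetwork.leafCount G) est →
      ∀ V ∈ EvolvingNetwork.detected est T (k T) (s T) (div T) (q T),
        V.1 ≤ R T ∧ (R T : ℝ) ≤ V.2 ∧ ((R T : ℝ) < s T (k T - 1) → (R T : ℝ) < V.2) := by
    filter_upwards [hs, hR, eventually_gt_atTop 0, eventually_ge_atTop T₀] with T hsT hRT hT hTT₀
    intro G hG est hest V hV
    have hk5 := (hk T).1
    have hT' : (0 : ℝ) < T := by exact_mod_cast hT
    have hcT : 0 < c * (T : ℝ) := by positivity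
    -- All candidate intervals lie in `[s 1, s (k - 1))`; leaving out the first and the last block
    -- gives both estimates a stretch of length about `c * T` or more.
    have hs1 : c * T ≤ s T 1 := by
      have := hsT.add_le hcT.le (show 0 < 1 by omega) (by omega)
      rwa [hsT.1, zero_add] at this
    have hs2 : s T (k T - 1) + c * T ≤ T := by
      have := hsT.add_le hcT.le (show k T - 1 < k T by omega) le_rfl
      rwa [hsT.2.1] at this
    have hstat : ∀ x z : ℝ, s T 1 ≤ x → x ≤ z → z ≤ s T (k T - 1) → _ := fun x z hx hxz hz =>
      hT₀ T hTT₀ (y T) (hy T) (R T) (hs1.trans hRT.1) (by linarith) _ hG est hest x z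
        (hs1.trans hx) hxz (by linarith)
    exact (EvolvingNetwork.detected_subset hT hc hk5 hsT (hdiv T) hRT.1 hRT.2 hstat (q T) (hq T) V
      hV).2.2.2
  refine ⟨EvolvingNetwork.tendsto_toMeasure_of_isTypical hε y _ ha _ ?_, fun hlt =>
    EvolvingNetwork.tendsto_toMeasure_of_isTypical hε y _ ha _ ?_⟩
  · filter_upwards [key] with T h G hG est hest V hV
    exact ⟨(h G hG est hest V hV).1, (h G hG est hest V hV).2.1⟩
  · filter_upwards [key, hlt] with T h hR' G hG est hest V hV
    exact ⟨(h G hG est hest V hV).1, (h G hG est hest V hV).2.2 hR'⟩
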